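/- **Definitions.** For a finite set $A$ of vectors in a lattice $\Lambda$ in a real vector space, the arithmetic Tutte polynomial is $$M_A(x,y)=\sum_{B\subseteq A} m(B)\,(x-1)^{r(A)-r(B)}(y-1)^{|B|-r(B)},$$ where $r(B)=\dim\operatorname{span}B$ and $m(B)$ is the index of $\mathbb ZB$ in $\operatorname{span}B\cap\Lambda$. The arithmetic coboundary polynomial is $\psi_A(X,Y)=(y-1)^{r(A)}M_A(x,y)$ with $x=\frac{X+Y-1}{Y-1}$, $y=Y$. Consider the (positive) root systems $$A_{n-1}=\{e_i-e_j: i<j\},\qquad D_n=\{e_i-e_j,\ e_i+e_j: i<j\},$$ $$B_n=D_n\cup\{e_i\},\qquad C_n=D_n\cup\{2e_i\},$$ where $1\le i,j\le n$, and their weight lattices $$\Lambda_W(A_{n-1})=\mathbb Z\{e_1,\dots,e_n\}/(\textstyle\sum e_i=0),\qquad \Lambda_W(C_n)=\mathbb Z\{e_1,\dots,e_n\},$$ $$\Lambda_W(B_n)=\Lambda_W(D_n)=\mathbb Z\{e_1,\dots,e_n,\tfrac12(e_1+\cdots+e_n)\}.$$ (For type $A$, the roots $e_i-e_j$ are taken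 in the quotient $\mathbb R^n/(\sum e_i=0)$.) Let $\psi^W_{\Phi}$ be the arithmetic coboundary polynomial of $\Phi$ in its weight lattice, and put $$\Psi^W_A=1+X\sum_{n\ge1}\psi^W_{A_{n-1}}(X,Y)\frac{Z^n}{n!},\qquad \Psi^W_\Phi=\sum_{n\ge0}\psi^W_{\Phi_n}(X,Y)\frac{Z^n}{n!}\quad(\Phi=B,C,D).$$ Let $\Psi_C$ be the series defined as $\Psi^W_C$, but with respect to the integer lattices $\mathbb Z^n$. Let $F(\alpha,\beta)=\sum_{n\ge0}\alpha^n\beta^{\binom n2}/n!$. Powers $S^c$ of formal power series $S$ in $Z$ with constant term $1$ are given by the binomial series $S^c=\sum_{k\ge0}\binom ck(S-1)^k$. **Theorem.** For each $n\ge1$ let $\omega_n\in\mathbb C$ be a primitive $n$th root of unity and let $\varphi$ be Euler's totient function. Then, as formal power series, $$\Psi^W_A=1+\sum_{n\ge1}\varphi(n)\left(\left[\prod_{k=0}^{n-1}F(\omega_n^kZ,Y)\right]^{X/n}-1\right),$$ where only finitely many terms of the sum contribute to the coefficient of any given power of $Z$; $$1+\Psi^W_B=F(2Z,Y)^{\frac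 X4-1}F(Z,Y^2)F(YZ,Y^2)\left[F(2Z,Y)^{\frac X4}+F(-2Z,Y)^{\frac X4}\right],$$ $$\Psi^W_C=\Psi_C=F(2Z,Y)^{\frac X2-1}F(YZ,Y^2)^2,$$ $$1+(X-1)Z+\Psi^W_D=F(2Z,Y)^{\frac X4-1}F(Z,Y^2)^2\left[F(2Z,Y)^{\frac X4}+F(-2Z,Y)^{\frac X4}\right].$$ In particular, for types $B$ and $D$ the coefficients of $Z^n$ on the right-hand sides are $\psi^W_{B_n}/n!$ for all $n\ge1$ and $\psi^W_{D_n}/n!$ for all $n\ge2$. -/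

import Mathlib

namespace ArithmeticTutte

open Submodule

section Configurations

variable {V : Type*} [AddCommGroup V] [Module ℝ V]

/-- The rank of a finite set of vectors: the dimension of its real span. -/
noncomputable def rank (B : Finset V) : ℕ :=
  Module.finrank ℝ (span ℝ (B : Set V))

/-- The multiplicity `m(B)`: the index of `ℤB` as a sublattice of `span B ∩ Λ`. -/
noncomputable def multiplicity (Λ : Submodule ℤ V) (B : Finset V) : ℕ :=
  (span ℤ (B : Set V)).toAddSubgroup.relIndex
    ((span ℝ (B : Set V)).restrictScalars ℤ ⊓ Λ).toAddSubgroup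

/-- The arithmetic Tutte polynomial `M_A(x,y)` of a finite set `A` of vectors in the lattice `Λ`;
the variables `x`, `y` are `MvPolynomial.X 0`, `MvPolynomial.X 1`. -/
noncomputable def arithmeticTutte (Λ : Submodule ℤ V) (A : Finset V) : MvPolynomial (Fin 2) ℤ :=
  ∑ B ∈ A.powerset, (multiplicity Λ B : MvPolynomial (Fin 2) ℤ) *
    (MvPolynomial.X 0 - 1) ^ (rank A - rank B) * (MvPolynomial.X 1 - 1) ^ (B.card - rank B)

/-- The field `ℂ(X, Y)` of rational functions, over which we take formal power series in `Z`. -/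
abbrev RatXY : Type := FractionRing (MvPolynomial (Fin 2) ℂ)

/-- The indeterminate `X`. -/
noncomputable def varX : RatXY := algebraMap (MvPolynomial (Fin 2) ℂ) RatXY (MvPolynomial.X 0)

/-- The indeterminate `Y`. -/
noncomputable def varY : RatXY := algebraMap (MvPolynomial (Fin 2) ℂ) RatXY (MvPolynomial.X 1)

/-- The arithmetic coboundary polynomial `ψ_A(X,Y) = (y-1)^{r(A)} M_A(x,y)` where
`x = (X+Y-1)/(Y-1)` and `y = Y`. -/
noncomputable def coboundary (Λ : Submodule ℤ V) (A : Finset V) : RatXY :=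
  (varY - 1) ^ rank A *
    MvPolynomial.aeval ![(varX + varY - 1) / (varY - 1), varY] (arithmeticTutte Λ A)

end Configurations

section RootSystems

/-- The standard basis vector `e_i` of `ℝⁿ`. -/
def e {n : ℕ} (i : Fin n) : Fin n → ℝ := Pi.single i 1

/-- The pairs `(i, j)` with `i < j`. -/
def pairs (n : ℕ) : Finset (Fin n × Fin n) := Finset.univ.filter fun p => p.1 < p.2

/-- The space `ℝⁿ / (e_1 + ⋯ + e_n = 0)`. -/
abbrev SpaceA (n : ℕ) : Type := (Fin n → ℝ) ⧸ span ℝ {(∑ i, e i : Fin n → ℝ)}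

/-- The class of `e_i` in `ℝⁿ / (e_1 + ⋯ + e_n = 0)`. -/
def eA {n : ℕ} (i : Fin n) : SpaceA n := Submodule.Quotient.mk (e i)

open Classical in
/-- The positive roots `e_i - e_j` (`i < j`) of `A_{n-1}`, in `ℝⁿ / (e_1 + ⋯ + e_n = 0)`. -/
noncomputable def rootsA (n : ℕ) : Finset (SpaceA n) :=
  (pairs n).image fun p => eA p.1 - eA p.2

open Classical in
/-- The positive roots `e_i - e_j`, `e_i + e_j` (`i < j`) of `D_n`. -/
noncomputable def rootsD (n : ℕ) : Finset (Fin n → ℝ) :=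
  ((pairs n).image fun p => e p.1 - e p.2) ∪ ((pairs n).image fun p => e p.1 + e p.2)

open Classical in
/-- The positive roots `e_i - e_j`, `e_i + e_j` (`i < j`) and `e_i` of `B_n`. -/
noncomputable def rootsB (n : ℕ) : Finset (Fin n → ℝ) :=
  rootsD n ∪ Finset.univ.image fun i => e i

open Classical in
/-- The positive roots `e_i - e_j`, `e_i + e_j` (`i < j`) and `2e_i` of `C_n`. -/
noncomputable def rootsC (n : ℕ) : Finset (Fin n → ℝ) :=
  rootsD n ∪ Finset.univ.image fun i => (2 : ℝ) • e i

/-- The integer lattice `ℤ{e_1, …, e_n}`. -/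
def integerLattice (n : ℕ) : Submodule ℤ (Fin n → ℝ) :=
  span ℤ (Set.range e)

/-- The weight lattice `ℤ{e_1, …, e_n} / (e_1 + ⋯ + e_n = 0)` of `A_{n-1}`. -/
def weightLatticeA (n : ℕ) : Submodule ℤ (SpaceA n) :=
  span ℤ (Set.range eA)

/-- The weight lattice `ℤ{e_1, …, e_n, (e_1 + ⋯ + e_n)/2}` of `B_n`. -/
noncomputable def weightLatticeB (n : ℕ) : Submodule ℤ (Fin n → ℝ) :=
  span ℤ (Set.range e ∪ {(1 / 2 : ℝ) • ∑ i, e i})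

/-- The weight lattice `ℤ{e_1, …, e_n}` of `C_n`. -/
def weightLatticeC (n : ℕ) : Submodule ℤ (Fin n → ℝ) :=
  span ℤ (Set.range e)

/-- The weight lattice `ℤ{e_1, …, e_n, (e_1 + ⋯ + e_n)/2}` of `D_n`. -/
noncomputable def weightLatticeD (n : ℕ) : Submodule ℤ (Fin n → ℝ) :=
  span ℤ (Set.range e ∪ {(1 / 2 : ℝ) • ∑ i, e i})

end RootSystems

section Series

open PowerSeries

/-- The exponential generating function `∑_{n ≥ 0} a_n Z^n / n!`. -/
noncomputable def egf (a : ℕ → RatXY) : PowerSeries RatXY :=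
  mk fun n => a n / (n.factorial : RatXY)

/-- `Ψ^W_A = 1 + X ∑_{n ≥ 1} ψ^W_{A_{n-1}}(X,Y) Z^n / n!`. -/
noncomputable def PsiWA : PowerSeries RatXY :=
  egf fun n => if n = 0 then 1 else varX * coboundary (weightLatticeA n) (rootsA n)

/-- `Ψ^W_B = ∑_{n ≥ 0} ψ^W_{B_n}(X,Y) Z^n / n!`. -/
noncomputable def PsiWB : PowerSeries RatXY :=
  egf fun n => coboundary (weightLatticeB n) (rootsB n)

/-- `Ψ^W_C = ∑_{n ≥ 0} ψ^W_{C_n}(X,Y) Z^n / n!`. -/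
noncomputable def PsiWC : PowerSeries RatXY :=
  egf fun n => coboundary (weightLatticeC n) (rootsC n)

/-- `Ψ^W_D = ∑_{n ≥ 0} ψ^W_{D_n}(X,Y) Z^n / n!`. -/
noncomputable def PsiWD : PowerSeries RatXY :=
  egf fun n => coboundary (weightLatticeD n) (rootsD n)

/-- `Ψ_C = ∑_{n ≥ 0} ψ_{C_n}(X,Y) Z^n / n!`, with respect to the integer lattices. -/
noncomputable def PsiC : PowerSeries RatXY :=
  egf fun n => coboundary (integerLattice n) (rootsC n)

/-- The deformed exponential function
`F(αZ, β) = ∑_{n ≥ 0} (αZ)^n β^(n choose 2) / n!`, as a formal power series in `Z`. -/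
noncomputable def F (α β : RatXY) : PowerSeries RatXY :=
  mk fun n => α ^ n * β ^ (n.choose 2) / (n.factorial : RatXY)

/-- The power `S^c = ∑_{k ≥ 0} (c choose k) (S - 1)^k` of a formal power series `S` with
constant term `1`, with exponent `c` in the coefficient field. -/
noncomputable def power (S : PowerSeries RatXY) (c : RatXY) : PowerSeries RatXY :=
  (PowerSeries.binomialSeries RatXY c).subst (S - 1)

/-- The family `f` of formal power series in `Z` has the formal sum `g`: for each `N`, only
finitely many members have a nonzero coefficient of `Z^N`, and these coefficients add up to the
coefficient of `Z^N` in `g`. -/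
def HasFormalSum {ι : Type*} (f : ι → PowerSeries RatXY) (g : PowerSeries RatXY) : Prop :=
  ∀ N : ℕ, (Function.support fun i => coeff N (f i)).Finite ∧
    ∑ᶠ i, coeff N (f i) = coeff N g

end Series

end ArithmeticTutte

namespace ArithmeticTutte

/-! ### Weighted colourings and the exponential formula -/

section ColouringCounts

open Finset

variable {K : Type*} [Field K]

/-! The proof is a finite field method on the torus `Hom(Λ, ℤ/q)`. Smith normal form shows that
`m(B) q^(rk Λ - r(B))` of its points vanish on `B` whenever `m(B)` divides `q` (`card_vanishing`).
Expanding a product over subsets of `A`, the points weighted by `Y` to the number of vectors of `A`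
they kill therefore sum to `q^(rk Λ - r(A)) ψ_A(q, Y)` for all sufficiently divisible `q`
(`exists_coboundary_polynomial`).

For root systems a point of the torus is a colouring of the indices by `ℤ/q`, and the exponential
formula (`sum_colourings`) turns the count into a product of deformed exponentials, one per colour.

In types B, C, D the colours are the classes of `ℤ/q` modulo sign, with `4 ∣ q`: a pair in a
two-element class kills one of `e_i ± e_j`, a pair in the class of `0` or `q/2` kills both
(`sum_signed_colourings`). For the lattice containing `½∑ e_i`, a point is a colouring with a chosen
half of its sum; the number of halves is `1 + (-1)^(sum)`, and the sign produces the summand with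
`F(-2Z, Y)` (`sum_half_eq`).

In type A the colourings must have sum zero. Orthogonality of characters of `ℤ/q` detects this; each
of the `φ(d)` characters of order `d` contributes the `q/d`-th power of a product over the `d`-th
roots of unity (`sum_colourings_sum_eq_zero`).

Each coefficient on either side is a polynomial in `X`, so agreement at infinitely many `q` gives
the identities. -/

/-- The deformed exponential series over an arbitrary field. -/
noncomputable def deformedExp (α β : K) : PowerSeries K :=
  PowerSeries.mk fun n => α ^ n * β ^ (n.choose 2) / (n.factorial : K)

theorem card_pairs_lt {ι : Type*} [LinearOrder ι] (s : Finset ι) :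
    ((s ×ˢ s).filter fun p => p.1 < p.2).card = s.card.choose 2 := by
  induction s using Finset.induction_on_max with
  | empty => simp
  | insert a s ha ih =>
    have hna : a ∉ s := fun h => lt_irrefl _ (ha a h)
    have : ((insert a s ×ˢ insert a s).filter fun p => p.1 < p.2) =
        ((s ×ˢ s).filter fun p => p.1 < p.2) ∪ s.image fun x => (x, a) := by
      ext ⟨x, y⟩
      simp only [mem_filter, mem_product, mem_insert, mem_union, mem_image, Prod.mk.injEq]
      constructor
      · rintro ⟨⟨rfl | hx, rfl | hy⟩, h⟩
        · exact absurd h (lt_irrefl _)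
        · exact absurd h (not_lt.2 (ha _ hy).le)
        · exact Or.inr ⟨x, hx, rfl, rfl⟩
        · exact Or.inl ⟨⟨hx, hy⟩, h⟩
      · rintro (⟨⟨hx, hy⟩, h⟩ | ⟨z, hz, rfl, rfl⟩)
        · exact ⟨⟨Or.inr hx, Or.inr hy⟩, h⟩
        · exact ⟨⟨Or.inr hz, Or.inl rfl⟩, ha _ hz⟩
    rw [this, card_union_of_disjoint, ih, card_image_of_injective, card_insert_of_notMem hna,
      Nat.choose_succ_succ' s.card 1, Nat.choose_one_right, add_comm]
    · exact fun x y h => by simpa using h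
    · rw [Finset.disjoint_left]
      rintro ⟨x, y⟩ h h'
      simp only [mem_filter, mem_product, mem_image, Prod.mk.injEq] at h h'
      obtain ⟨z, hz, rfl, rfl⟩ := h'
      exact hna h.1.2

theorem prod_pairs_ite_eq {n : ℕ} {B : Type*} [Fintype B] [DecidableEq B] (g : B → K)
    (c : Fin n → B) :
    ∏ p ∈ pairs n, (if c p.1 = c p.2 then g (c p.1) else 1) =
      ∏ b, g b ^ ((univ.filter fun i => c i = b).card.choose 2) := by
  have h : ∀ b, g b ^ ((univ.filter fun i => c i = b).card.choose 2) =
      ∏ p ∈ pairs n, if c p.1 = b ∧ c p.2 = b then g b else 1 := by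
    intro b
    rw [← card_pairs_lt, ← prod_const, ← prod_filter]
    refine prod_congr ?_ fun _ _ => rfl
    ext p
    simp only [pairs, mem_filter, mem_product, mem_univ, true_and]
    tauto
  simp_rw [h]
  rw [prod_comm]
  refine prod_congr rfl fun p _ => ?_
  rw [prod_eq_single (c p.1)]
  · simp [eq_comm]
  · intro b _ hb
    rw [if_neg]
    exact fun h => hb h.1.symm
  · simp

/-- Expand `(∑ X_b)^n` once over colourings and once by the multinomial theorem, then apply the
linear functional `L` sending the monomial with exponent `l` to `w l`. -/
theorem sum_fibre_card {n : ℕ} {B : Type*} [Fintype B] [DecidableEq B] (w : (B → ℕ) → K) :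
    ∑ c : Fin n → B, w (fun b => (univ.filter fun i => c i = b).card) =
      ∑ l ∈ (univ : Finset B).piAntidiag n, (Nat.multinomial univ l : K) * w l := by
  let L : MvPolynomial B K →ₗ[K] K :=
    (MvPolynomial.basisMonomials B K).constr K fun l => w l
  have hL : ∀ l : B → ℕ, L (∏ b, MvPolynomial.X b ^ l b) = w l := by
    intro l
    have : (∏ b, MvPolynomial.X b ^ l b : MvPolynomial B K) =
        MvPolynomial.monomial (Finsupp.equivFunOnFinite.symm l) 1 := by
      rw [MvPolynomial.monomial_eq, Finsupp.prod_fintype _ _ (by simp)]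
      simp
    rw [this, ← congrFun (MvPolynomial.coe_basisMonomials B K) _]
    exact (MvPolynomial.basisMonomials B K).constr_basis K _ _
  have h1 := Finset.sum_pow' (univ : Finset B) (fun b => (MvPolynomial.X b : MvPolynomial B K)) n
  rw [Finset.sum_pow_eq_sum_piAntidiag] at h1
  have h2 := congrArg L h1
  rw [map_sum, map_sum, Fintype.piFinset_univ] at h2
  rw [← sum_congr rfl (fun c _ => ?_), ← h2]
  · refine sum_congr rfl fun l _ => ?_
    rw [← nsmul_eq_mul, map_nsmul, hL, nsmul_eq_mul]
  · rw [← hL]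
    congr 1
    rw [← Finset.prod_fiberwise (univ : Finset (Fin n)) c]
    refine prod_congr rfl fun b _ => ?_
    rw [← prod_const]
    exact (prod_congr rfl fun i hi => by rw [(mem_filter.1 hi).2]).symm

/-- Exponential formula: the weight depends only on the fibre sizes and factors over colours, and
the multinomial coefficient supplies the factorials in the product of series. -/
theorem sum_colourings [CharZero K] (n : ℕ) {B : Type*} [Fintype B] [DecidableEq B] (g h : B → K) :
    ∑ c : Fin n → B, (∏ p ∈ pairs n, (if c p.1 = c p.2 then g (c p.1) else 1)) * ∏ i, h (c i) =
      n.factorial * PowerSeries.coeff n (∏ b, deformedExp (h b) (g b)) := by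
  have h1 : ∀ c : Fin n → B, (∏ p ∈ pairs n, (if c p.1 = c p.2 then g (c p.1) else 1)) *
      ∏ i, h (c i) = (fun l : B → ℕ => ∏ b, (h b ^ l b * g b ^ (l b).choose 2))
        (fun b => (univ.filter fun i => c i = b).card) := by
    intro c
    simp only
    rw [prod_pairs_ite_eq, ← Finset.prod_fiberwise (univ : Finset (Fin n)) c, ← prod_mul_distrib]
    refine prod_congr rfl fun b _ => ?_
    rw [mul_comm, ← prod_const]
    congr 1
    exact prod_congr rfl fun i hi => by rw [(mem_filter.1 hi).2]
  rw [sum_congr rfl fun c _ => h1 c]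
  rw [sum_fibre_card fun l => ∏ b, (h b ^ l b * g b ^ (l b).choose 2), PowerSeries.coeff_prod, mul_sum]
  refine sum_bij' (fun l _ => Finsupp.equivFunOnFinite.symm l) (fun l _ => ⇑l) ?_ ?_ ?_ ?_ ?_
  · intro l hl
    simpa [mem_finsuppAntidiag] using hl
  · intro l hl
    simpa [mem_finsuppAntidiag] using hl
  · intro l _; rfl
  · intro l _; ext; rfl
  · intro l hl
    have hs : ∑ b, l b = n := by simpa using hl
    simp only [deformedExp, PowerSeries.coeff_mk, Finsupp.equivFunOnFinite_symm_apply_apply]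
    rw [prod_div_distrib, ← hs, ← Nat.multinomial_spec univ l]
    have : (∏ b, ((l b).factorial : K)) ≠ 0 :=
      prod_ne_zero_iff.2 fun b _ => Nat.cast_ne_zero.2 (Nat.factorial_ne_zero _)
    push_cast
    field_simp

end ColouringCounts

/-! ### Interpolation: power series with coefficients polynomial in a parameter -/

section PolynomialFamilies

open PowerSeries

variable {K : Type*} [Field K]

/-- A family of power series all of whose coefficients are polynomial in the parameter. -/
def IsPolynomialFamily (f : K → PowerSeries K) : Prop :=
  ∀ n, ∃ P : Polynomial K, ∀ c, coeff n (f c) = P.eval c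

theorem IsPolynomialFamily.const (S : PowerSeries K) : IsPolynomialFamily fun _ => S :=
  fun n => ⟨Polynomial.C (coeff n S), fun c => by simp⟩

theorem IsPolynomialFamily.add {f g : K → PowerSeries K} (hf : IsPolynomialFamily f)
    (hg : IsPolynomialFamily g) : IsPolynomialFamily fun c => f c + g c := fun n => by
  obtain ⟨P, hP⟩ := hf n
  obtain ⟨Q, hQ⟩ := hg n
  exact ⟨P + Q, fun c => by simp [hP, hQ]⟩

theorem IsPolynomialFamily.mul {f g : K → PowerSeries K} (hf : IsPolynomialFamily f)
    (hg : IsPolynomialFamily g) : IsPolynomialFamily fun c => f c * g c := fun n => by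
  choose P hP using hf
  choose Q hQ using hg
  exact ⟨∑ p ∈ Finset.HasAntidiagonal.antidiagonal n, P p.1 * Q p.2, fun c => by
    simp [coeff_mul, hP, hQ, Polynomial.eval_finsetSum]⟩

theorem IsPolynomialFamily.comp {f : K → PowerSeries K} (hf : IsPolynomialFamily f)
    (Q : Polynomial K) : IsPolynomialFamily fun c => f (Q.eval c) := fun n => by
  obtain ⟨P, hP⟩ := hf n
  exact ⟨P.comp Q, fun c => by simp [hP]⟩

theorem IsPolynomialFamily.sum {ι : Type*} (s : Finset ι) {f : ι → K → PowerSeries K}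
    (hf : ∀ i ∈ s, IsPolynomialFamily (f i)) : IsPolynomialFamily fun c => ∑ i ∈ s, f i c := by
  classical
  induction s using Finset.induction_on with
  | empty => simpa using IsPolynomialFamily.const (0 : PowerSeries K)
  | insert a s ha ih =>
    simp_rw [Finset.sum_insert ha]
    exact (hf a (Finset.mem_insert_self _ _)).add
      (ih fun i hi => hf i (Finset.mem_insert_of_mem hi))

/-- Agreement on nonzero multiples of `d` suffices, which matters because the torus count is valid
only for sufficiently divisible `q`. -/
theorem eval_eq_of_frequently_nat [CharZero K] {P Q : Polynomial K} {d : ℕ}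
    (hd : d ≠ 0) (h : ∀ q : ℕ, q ≠ 0 → d ∣ q → P.eval (q : K) = Q.eval (q : K)) (c : K) :
    P.eval c = Q.eval c := by
  rw [Polynomial.eq_of_infinite_eval_eq P Q]
  refine Set.Infinite.mono (s := Set.range fun k : ℕ => ((d * (k + 1) : ℕ) : K)) ?_
    (Set.infinite_range_of_injective ?_)
  · rintro _ ⟨k, rfl⟩
    exact h _ (by positivity) (Dvd.intro _ rfl)
  · intro a b hab
    simpa [hd] using hab

/-- Since `S - 1` has no constant term, its powers beyond the `n`-th do not reach degree `n`; the
finite sum that remains is visibly polynomial in `c`. -/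
theorem coeff_binomial_subst [BinomialRing K] {S : PowerSeries K} (hS : constantCoeff S = 1)
    (c : K) (n : ℕ) : coeff n ((binomialSeries K c).subst (S - 1)) =
      ∑ k ∈ Finset.range (n + 1), Ring.choose c k * coeff n ((S - 1) ^ k) := by
  have h0 : constantCoeff (S - 1) = 0 := by simp [hS]
  rw [coeff_subst' (HasSubst.of_constantCoeff_zero' h0), finsum_eq_sum_of_support_subset]
  · exact Finset.sum_congr rfl fun k _ => by simp [binomialSeries_coeff]
  · intro k hk
    by_contra hkn
    apply hk
    rw [Finset.coe_range, Set.mem_Iio, not_lt] at hkn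
    simp only
    rw [coeff_of_lt_order (n := n) (φ := (S - 1) ^ k), smul_zero]
    refine lt_of_lt_of_le ?_ (le_order_pow_of_constantCoeff_eq_zero k h0)
    exact_mod_cast hkn

theorem choose_eq_eval [CharZero K] [BinomialRing K] (c : K) (k : ℕ) :
    Ring.choose c k = (Polynomial.C ((k.factorial : K)⁻¹) * descPochhammer K k).eval c := by
  have h := Ring.descPochhammer_eq_factorial_smul_choose c k
  have hk : (k.factorial : K) ≠ 0 := Nat.cast_ne_zero.2 (Nat.factorial_ne_zero k)
  rw [nsmul_eq_mul, ← Polynomial.eval₂_smulOneHom_eq_smeval] at h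
  rw [Polynomial.eval_mul, Polynomial.eval_C, eq_inv_mul_iff_mul_eq₀ hk, ← h,
    ← descPochhammer_map (Int.castRingHom K), Polynomial.eval_map]
  congr 1
  exact RingHom.ext_int _ _

theorem isPolynomialFamily_binomial [CharZero K] [BinomialRing K] {S : PowerSeries K}
    (hS : constantCoeff S = 1) :
    IsPolynomialFamily fun c => (binomialSeries K c).subst (S - 1) := fun n =>
  ⟨∑ k ∈ Finset.range (n + 1), Polynomial.C ((k.factorial : K)⁻¹) * descPochhammer K k *
    Polynomial.C (coeff n ((S - 1) ^ k)), fun c => by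
    rw [coeff_binomial_subst hS, Polynomial.eval_finsetSum]
    exact Finset.sum_congr rfl fun k _ => by
      rw [choose_eq_eval, Polynomial.eval_mul (p := _ * _), Polynomial.eval_C]⟩

theorem binomial_subst_natCast [BinomialRing K] {S : PowerSeries K} (hS : constantCoeff S = 1)
    (m : ℕ) : (binomialSeries K (m : K)).subst (S - 1) = S ^ m := by
  have h0 : HasSubst (S - 1) := HasSubst.of_constantCoeff_zero' (by simp [hS])
  rw [binomialSeries_nat, subst_pow h0, subst_add h0, subst_X h0]
  congr 1
  rw [← coe_substAlgHom h0, map_one]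
  ring

end PolynomialFamilies

/-! ### Points of the finite torus and the arithmetic multiplicity -/

section LatticePoints

open Submodule Module

variable {V : Type*} [AddCommGroup V] [Module ℝ V] {ι : Type*} {c : ι → V}

/-- The homomorphism from the lattice `ℤc` to `R` with value `x i` at `c i` takes the value `r`
at `v`. -/
def HasValue {R : Type*} [AddCommGroup R] (hc : LinearIndependent ℝ c) (x : ι → R) (v : V)
    (r : R) : Prop :=
  ∃ h : v ∈ span ℤ (Set.range c),
    (Basis.span (hc.restrict_scalars' ℤ)).constr ℤ x ⟨v, h⟩ = r

namespace HasValue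

variable {R : Type*} [AddCommGroup R] {hc : LinearIndependent ℝ c} {x : ι → R} {v w : V} {r s : R}

theorem gen (i : ι) : HasValue hc x (c i) (x i) := by
  refine ⟨subset_span ⟨i, rfl⟩, ?_⟩
  have h := Basis.constr_basis
    (Basis.span (hc.restrict_scalars' ℤ)) ℤ x i
  refine Eq.trans (congrArg _ ?_) h
  exact (Basis.span_apply _ _).symm

theorem add (hv : HasValue hc x v r) (hw : HasValue hc x w s) : HasValue hc x (v + w) (r + s) := by
  obtain ⟨h, rfl⟩ := hv
  obtain ⟨h', rfl⟩ := hw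
  exact ⟨add_mem h h', by rw [← map_add]; rfl⟩

theorem sub (hv : HasValue hc x v r) (hw : HasValue hc x w s) : HasValue hc x (v - w) (r - s) := by
  obtain ⟨h, rfl⟩ := hv
  obtain ⟨h', rfl⟩ := hw
  exact ⟨sub_mem h h', by rw [← map_sub]; rfl⟩

theorem zero : HasValue hc x 0 0 := ⟨zero_mem _, map_zero _⟩

theorem neg (hv : HasValue hc x v r) : HasValue hc x (-v) (-r) := by
  simpa using zero.sub hv

theorem sum {κ : Type*} (t : Finset κ) {v : κ → V} {r : κ → R}
    (h : ∀ k ∈ t, HasValue hc x (v k) (r k)) : HasValue hc x (∑ k ∈ t, v k) (∑ k ∈ t, r k) := by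
  classical
  induction t using Finset.induction_on with
  | empty => simpa using zero
  | insert a t ha ih =>
    rw [Finset.sum_insert ha, Finset.sum_insert ha]
    exact (h a (Finset.mem_insert_self _ _)).add
      (ih fun k hk => h k (Finset.mem_insert_of_mem hk))

theorem iff_eq (hv : HasValue hc x v r) (s : R) : HasValue hc x v s ↔ r = s := by
  obtain ⟨h, rfl⟩ := hv
  exact ⟨fun ⟨_, h'⟩ => h', fun h' => ⟨h, h'⟩⟩

end HasValue

variable [Fintype ι]

/-- Smith normal form of `ℤB` inside the lattice. The new basis stays independent over `ℝ` because
it has the same cardinality and real span as `c`. -/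
theorem exists_adapted_basis (hc : LinearIndependent ℝ c) {B : Finset V}
    (hB : (B : Set V) ⊆ span ℤ (Set.range c)) :
    ∃ (b : Basis ι ℤ (span ℤ (Set.range c))) (k : ℕ) (f : Fin k ↪ ι) (a : Fin k → ℤ),
      LinearIndependent ℝ (fun i => (b i : V)) ∧ (∀ i, a i ≠ 0) ∧
      span ℤ (B : Set V) = span ℤ (Set.range fun i => a i • (b (f i) : V)) := by
  set Λ := span ℤ (Set.range c) with hΛ
  let cb : Basis ι ℤ Λ := Basis.span (hc.restrict_scalars' ℤ)
  obtain ⟨k, snf⟩ := Submodule.smithNormalForm cb ((span ℤ (B : Set V)).comap Λ.subtype)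
  refine ⟨snf.bM, k, snf.f, snf.a, ?_, ?_, ?_⟩
  · rw [linearIndependent_iff_card_eq_finrank_span] at hc ⊢
    rw [hc]
    unfold Set.finrank
    have h1 : span ℤ (Set.range fun i => (snf.bM i : V)) = Λ := by
      have := congrArg (Submodule.map Λ.subtype) snf.bM.span_eq
      rw [Submodule.map_span, ← Set.range_comp, Submodule.map_top, Submodule.range_subtype] at this
      exact this
    have h2 := congrArg (fun S : Submodule ℤ V => span ℝ (S : Set V)) (h1.trans hΛ)
    simp only [span_span_of_tower] at h2
    rw [h2]
  · intro i hi
    apply snf.bN.ne_zero i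
    have := snf.snf i
    rw [hi, zero_smul] at this
    exact_mod_cast this
  · have h1 := congrArg (Submodule.map ((span ℤ (B : Set V)).comap Λ.subtype).subtype)
      snf.bN.span_eq
    have h2 := congrArg (Submodule.map Λ.subtype) h1
    rw [Submodule.map_top, Submodule.range_subtype, Submodule.map_comap_subtype,
      Submodule.map_span, Submodule.map_span, ← Set.range_comp, ← Set.range_comp] at h2
    rw [inf_eq_right.2 (span_le.2 hB)] at h2
    refine h2.symm.trans (congrArg (span ℤ) (congrArg Set.range (funext fun i => ?_)))
    simp [snf.snf]

theorem card_zmod_mul_eq_zero {q : ℕ} [NeZero q] {a : ℤ} (h : a.natAbs ∣ q) :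
    (Finset.univ.filter fun y : ZMod q => a • y = 0).card = a.natAbs := by
  have h1 := IsAddCyclic.card_nsmulAddMonoidHom_ker (G := ZMod q) a.natAbs
  rw [Nat.card_zmod, Nat.gcd_eq_right h] at h1
  rw [← h1, ← Fintype.card_subtype, ← Nat.card_eq_fintype_card]
  refine Nat.card_congr (Equiv.subtypeEquivRight fun y => ?_)
  rw [AddMonoidHom.mem_ker, nsmulAddMonoidHom_apply]
  rcases Int.natAbs_eq a with h | h
  · nth_rw 1 [h]; rw [natCast_zsmul]
  · nth_rw 1 [h]; rw [neg_smul, natCast_zsmul, neg_eq_zero]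

theorem card_pi_smul_eq_zero {q k : ℕ} [NeZero q] [DecidableEq ι] (f : Fin k ↪ ι) (a : Fin k → ℤ)
    (h : ∀ i, (a i).natAbs ∣ q) :
    (Finset.univ.filter fun y : ι → ZMod q => ∀ i, a i • y (f i) = 0).card =
      (∏ i, (a i).natAbs) * q ^ (Fintype.card ι - k) := by
  have h1 : (Finset.univ.filter fun y : ι → ZMod q => ∀ i, a i • y (f i) = 0) =
      Fintype.piFinset fun j => Finset.univ.filter fun z : ZMod q => ∀ i, f i = j → a i • z = 0 := by
    ext y
    simp only [Finset.mem_filter, Finset.mem_univ, true_and, Fintype.mem_piFinset]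
    exact ⟨fun h j i hij => hij ▸ h i, fun h i => h _ i rfl⟩
  rw [h1, Fintype.card_piFinset, ← Finset.prod_mul_prod_compl (Finset.univ.map f), Finset.prod_map]
  congr 1
  · refine Finset.prod_congr rfl fun i _ => ?_
    rw [← card_zmod_mul_eq_zero (h i)]
    congr 1
    ext z
    simp
  · rw [Finset.prod_congr rfl (g := fun _ => q), Finset.prod_const, Finset.card_compl,
      Finset.card_map, Finset.card_univ, Fintype.card_fin]
    intro j hj
    rw [Finset.filter_true_of_mem, Finset.card_univ, ZMod.card]
    rintro z - i rfl
    simp at hj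

/-- In adapted coordinates `span B ∩ Λ` is the free group on the vectors `b (f i)` and `ℤB` is its
diagonal sublattice with entries `a i`. -/
theorem multiplicity_and_rank {B : Finset V} {k : ℕ}
    (b : Basis ι ℤ (span ℤ (Set.range c))) (f : Fin k ↪ ι) (a : Fin k → ℤ)
    (hb : LinearIndependent ℝ (fun i => (b i : V))) (ha : ∀ i, a i ≠ 0)
    (hB : span ℤ (B : Set V) = span ℤ (Set.range fun i => a i • (b (f i) : V))) :
    rank B = k ∧ multiplicity (span ℤ (Set.range c)) B = ∏ i, (a i).natAbs := by
  classical
  let w : Fin k → V := fun i => b (f i)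
  have hw : LinearIndependent ℝ w := hb.comp f f.injective
  have hspan : span ℝ (B : Set V) = span ℝ (Set.range w) := by
    have h2 := congrArg (fun S : Submodule ℤ V => span ℝ (S : Set V)) hB
    simp only [span_span_of_tower] at h2
    rw [h2]
    apply le_antisymm
    · rw [span_le]
      rintro _ ⟨i, rfl⟩
      simp only [SetLike.mem_coe]
      rw [← Int.cast_smul_eq_zsmul ℝ]
      exact smul_mem _ _ (subset_span ⟨i, rfl⟩)
    · rw [span_le]
      rintro _ ⟨i, rfl⟩
      have hai : (a i : ℝ) ≠ 0 := Int.cast_ne_zero.2 (ha i)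
      have : w i = (a i : ℝ)⁻¹ • (a i • w i) := by
        rw [← Int.cast_smul_eq_zsmul ℝ, smul_smul, inv_mul_cancel₀ hai, one_smul]
      rw [this]
      exact smul_mem _ _ (subset_span ⟨i, rfl⟩)
  refine ⟨?_, ?_⟩
  · unfold rank
    rw [hspan, finrank_span_eq_card hw, Fintype.card_fin]
  let φ : (Fin k → ℤ) →ₗ[ℤ] V := Fintype.linearCombination ℤ w
  have hφ : Function.Injective φ :=
    fun y z h => funext <| Fintype.linearIndependent_iffₛ.1 (hw.restrict_scalars' ℤ) y z h
  have hsat : (span ℝ (B : Set V)).restrictScalars ℤ ⊓ span ℤ (Set.range c) =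
      (⊤ : Submodule ℤ (Fin k → ℤ)).map φ := by
    rw [hspan]
    ext v
    simp only [mem_inf, restrictScalars_mem, mem_map, mem_top, true_and]
    constructor
    · rintro ⟨h1, h2⟩
      obtain ⟨t, ht⟩ := (mem_span_range_iff_exists_fun ℝ).1 h1
      let z := b.repr ⟨v, h2⟩
      have hz : ∑ j, (z j : ℝ) • (b j : V) = v := by
        have := congrArg (span ℤ (Set.range c)).subtype (b.sum_repr ⟨v, h2⟩)
        rw [map_sum] at this
        simp only [Int.cast_smul_eq_zsmul]
        exact this
      -- Two expansions of `v` in the real-independent family `b`, one integral and one supported on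
      -- the range of `f`: comparing them makes each `t i` an integer.
      have hzero : ∑ j, ((z j : ℝ) - ∑ i, if f i = j then t i else 0) • (b j : V) = 0 := by
        simp_rw [sub_smul, Finset.sum_sub_distrib, hz, Finset.sum_smul]
        rw [Finset.sum_comm, sub_eq_zero, ← ht]
        refine Finset.sum_congr rfl fun i _ => ?_
        simp [ite_smul, w]
      have hall := Fintype.linearIndependent_iff.1 hb _ hzero
      refine ⟨fun i => z (f i), ?_⟩
      rw [← ht, Fintype.linearCombination_apply]
      refine Finset.sum_congr rfl fun i _ => ?_
      have := hall (f i)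
      rw [← Int.cast_smul_eq_zsmul ℝ]
      congr 1
      simpa [sub_eq_zero] using this
    · rintro ⟨y, rfl⟩
      rw [Fintype.linearCombination_apply]
      refine ⟨sum_mem fun i _ => ?_, sum_mem fun i _ => smul_mem _ _ (b (f i)).2⟩
      rw [← Int.cast_smul_eq_zsmul ℝ]
      exact smul_mem _ _ (subset_span ⟨i, rfl⟩)
  have hN : (span ℤ (B : Set V)).toAddSubgroup =
      (AddSubgroup.pi Set.univ fun i => AddSubgroup.zmultiples (a i)).map φ.toAddMonoidHom := by
    rw [hB]
    ext v
    rw [Submodule.mem_toAddSubgroup, mem_span_range_iff_exists_fun, AddSubgroup.mem_map]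
    constructor
    · rintro ⟨y, rfl⟩
      refine ⟨fun i => y i * a i, ?_, ?_⟩
      · intro i _
        exact ⟨y i, by simp⟩
      · simp [φ, Fintype.linearCombination_apply, mul_smul, w]
    · rintro ⟨y, hy, rfl⟩
      choose z hz using fun i => hy i (Set.mem_univ i)
      refine ⟨z, ?_⟩
      simp only [φ, LinearMap.toAddMonoidHom_coe, Fintype.linearCombination_apply, w]
      refine Finset.sum_congr rfl fun i _ => ?_
      rw [← hz i, ← mul_smul]
      simp
  unfold multiplicity
  rw [hsat, hN]
  have h3 : ((⊤ : Submodule ℤ (Fin k → ℤ)).map φ).toAddSubgroup =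
      (⊤ : AddSubgroup (Fin k → ℤ)).map φ.toAddMonoidHom := rfl
  rw [h3, AddSubgroup.relIndex_map_map_of_injective _ _ hφ, AddSubgroup.relIndex_top_right,
    AddSubgroup.index_pi]
  simp [Int.index_zmultiples]

/-- Passing from the coordinates given by `c` to an adapted basis turns vanishing on `B` into the
independent conditions `a i • y (f i) = 0`. -/
theorem card_vanishing (hc : LinearIndependent ℝ c) {B : Finset V}
    (hB : (B : Set V) ⊆ span ℤ (Set.range c)) :
    multiplicity (span ℤ (Set.range c)) B ≠ 0 ∧ ∀ (q : ℕ) [NeZero q],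
      multiplicity (span ℤ (Set.range c)) B ∣ q →
      Nat.card {x : ι → ZMod q // ∀ v ∈ B, HasValue hc x v 0} =
        multiplicity (span ℤ (Set.range c)) B * q ^ (Fintype.card ι - rank B) := by
  classical
  obtain ⟨b, k, f, a, hb, ha, hBa⟩ := exists_adapted_basis hc hB
  obtain ⟨hr, hm⟩ := multiplicity_and_rank b f a hb ha hBa
  rw [hr, hm]
  refine ⟨Finset.prod_ne_zero_iff.2 fun i _ => Int.natAbs_ne_zero.2 (ha i), fun q _ hq => ?_⟩
  rw [← card_pi_smul_eq_zero f a
    fun i => (Finset.dvd_prod_of_mem (fun i => (a i).natAbs) (Finset.mem_univ i)).trans hq,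
    ← Fintype.card_subtype, ← Nat.card_eq_fintype_card]
  let cb : Basis ι ℤ (span ℤ (Set.range c)) :=
    Basis.span (hc.restrict_scalars' ℤ)
  refine Nat.card_congr (Equiv.subtypeEquiv
    ((cb.constr ℤ (M' := ZMod q)).trans (b.constr ℤ (M' := ZMod q)).symm).toEquiv fun x => ?_)
  set p := cb.constr ℤ x with hp
  have h1 : (∀ v ∈ B, HasValue hc x v 0) ↔
      (B : Set V) ⊆ (LinearMap.ker p).map (span ℤ (Set.range c)).subtype := by
    refine forall₂_congr fun v _ => ?_
    simp only [SetLike.mem_coe, mem_map, LinearMap.mem_ker]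
    exact ⟨fun ⟨h, h'⟩ => ⟨⟨v, h⟩, h', rfl⟩, fun ⟨⟨v', h⟩, h', e⟩ => by
      obtain rfl : v' = v := e
      exact ⟨h, h'⟩⟩
  rw [h1, ← span_le, hBa, span_le, Set.range_subset_iff]
  refine forall_congr' fun i => ?_
  have h2 : ((cb.constr ℤ (M' := ZMod q)).trans (b.constr ℤ (M' := ZMod q)).symm).toEquiv x (f i) =
      p (b (f i)) := rfl
  rw [h2, ← map_zsmul]
  simp only [SetLike.mem_coe, mem_map, LinearMap.mem_ker]
  constructor
  · rintro ⟨y, hy, e⟩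
    obtain rfl : y = a i • b (f i) := Subtype.ext e
    exact hy
  · exact fun h => ⟨_, h, rfl⟩

theorem rank_mono {A B : Finset V} (h : B ⊆ A) : rank B ≤ rank A := by
  have : FiniteDimensional ℝ (span ℝ (A : Set V)) := FiniteDimensional.span_finset ℝ A
  exact finrank_mono (span_mono (Finset.coe_subset.2 h))

theorem varY_sub_one_ne_zero : varY - 1 ≠ 0 := by
  rw [varY, ← map_one (algebraMap (MvPolynomial (Fin 2) ℂ) RatXY), ← map_sub]
  refine (map_ne_zero_iff _ (IsFractionRing.injective _ _)).2 fun h => ?_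
  have := congrArg (MvPolynomial.eval fun _ => (0 : ℂ)) h
  simp at this

/-- Here `x - 1 = X / (Y - 1)`, and the exponents of `Y - 1` add up to `|B|`. -/
theorem coboundary_eq_sum (Λ : Submodule ℤ V) (A : Finset V) :
    coboundary Λ A = ∑ B ∈ A.powerset,
      (multiplicity Λ B : RatXY) * (varY - 1) ^ B.card * varX ^ (rank A - rank B) := by
  have hY := varY_sub_one_ne_zero
  unfold coboundary arithmeticTutte
  rw [map_sum, Finset.mul_sum]
  refine Finset.sum_congr rfl fun B hB => ?_
  have h1 : rank B ≤ rank A := rank_mono (Finset.mem_powerset.1 hB)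
  have h2 : rank B ≤ B.card := finrank_span_finset_le_card B
  have h3 : (varX + varY - 1) / (varY - 1) - 1 = varX / (varY - 1) := by
    field_simp
    ring
  simp only [map_mul, map_natCast, map_pow, map_sub, MvPolynomial.aeval_X, map_one,
    Matrix.cons_val_zero, Matrix.cons_val_one]
  rw [h3, div_pow]
  obtain ⟨u, hu⟩ := Nat.exists_eq_add_of_le h1
  obtain ⟨v, hv⟩ := Nat.exists_eq_add_of_le h2
  rw [hu, hv, Nat.add_sub_cancel_left, Nat.add_sub_cancel_left, pow_add, pow_add]
  field_simp

open Classical in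
-- Write each factor as `1 + (t - 1)·[v is killed]`, expand over subsets `B`, and exchange the sums.
theorem sum_prod_vanishing {K : Type*} [CommRing K] (hc : LinearIndependent ℝ c) {A : Finset V}
    (hA : (A : Set V) ⊆ span ℤ (Set.range c)) (t : K) {q : ℕ} [NeZero q]
    (hq : ∀ B ⊆ A, multiplicity (span ℤ (Set.range c)) B ∣ q) :
    ∑ x : ι → ZMod q, ∏ v ∈ A, (if HasValue hc x v 0 then t else 1) =
      ∑ B ∈ A.powerset, (multiplicity (span ℤ (Set.range c)) B : K) * (t - 1) ^ B.card *
        (q : K) ^ (Fintype.card ι - rank B) := by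
  have h1 : ∀ x : ι → ZMod q, ∏ v ∈ A, (if HasValue hc x v 0 then t else 1) =
      ∑ B ∈ A.powerset, if ∀ v ∈ B, HasValue hc x v 0 then (t - 1) ^ B.card else 0 := by
    intro x
    rw [Finset.prod_congr rfl (g := fun v => 1 + if HasValue hc x v 0 then t - 1 else 0),
      Finset.prod_one_add]
    · refine Finset.sum_congr rfl fun B _ => ?_
      rw [Finset.prod_ite_zero, Finset.prod_const]
    · intro v _
      split_ifs <;> ring
  simp_rw [h1]
  rw [Finset.sum_comm]
  refine Finset.sum_congr rfl fun B hB => ?_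
  have hBA := Finset.mem_powerset.1 hB
  have h2 := (card_vanishing hc (B := B) ((Finset.coe_subset.2 hBA).trans hA)).2 q (hq B hBA)
  rw [Nat.card_eq_fintype_card, Fintype.card_subtype] at h2
  rw [← Finset.sum_filter, Finset.sum_const, h2, nsmul_eq_mul]
  push_cast
  ring

open Classical in
/-- Counting points of the finite torus `Hom(Λ, ℤ/q)` computes the coboundary polynomial. -/
theorem exists_coboundary_polynomial (hc : LinearIndependent ℝ c) {A : Finset V}
    (hA : (A : Set V) ⊆ span ℤ (Set.range c)) :
    ∃ P : Polynomial RatXY,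
      P.eval varX = varX ^ (Fintype.card ι - rank A) * coboundary (span ℤ (Set.range c)) A ∧
      ∃ d : ℕ, d ≠ 0 ∧ ∀ (q : ℕ) [NeZero q], d ∣ q → P.eval (q : RatXY) =
        ∑ x : ι → ZMod q, ∏ v ∈ A, (if HasValue hc x v 0 then varY else 1) := by
  -- The period is the product of all multiplicities, so that every `m(B)` divides each admissible
  -- `q`.
  refine ⟨∑ B ∈ A.powerset, Polynomial.C ((multiplicity (span ℤ (Set.range c)) B : RatXY) *
    (varY - 1) ^ B.card) * Polynomial.X ^ (Fintype.card ι - rank B), ?_,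
    ∏ B ∈ A.powerset, multiplicity (span ℤ (Set.range c)) B, ?_, ?_⟩
  · rw [coboundary_eq_sum, Finset.mul_sum, Polynomial.eval_finsetSum]
    refine Finset.sum_congr rfl fun B hB => ?_
    have h1 : rank B ≤ rank A := rank_mono (Finset.mem_powerset.1 hB)
    have h2 : rank A ≤ Fintype.card ι := by
      unfold rank
      rw [← finrank_span_eq_card hc]
      have : FiniteDimensional ℝ (span ℝ (Set.range c)) :=
        FiniteDimensional.span_of_finite ℝ (Set.finite_range c)
      refine finrank_mono (span_le.2 (hA.trans ?_))
      exact span_subset_span ℤ ℝ _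
    have h3 : Fintype.card ι - rank B = (Fintype.card ι - rank A) + (rank A - rank B) := by omega
    rw [h3, Polynomial.eval_mul, Polynomial.eval_C, Polynomial.eval_pow, Polynomial.eval_X,
      pow_add]
    ring
  · exact Finset.prod_ne_zero_iff.2 fun B hB => (card_vanishing hc
      ((Finset.coe_subset.2 (Finset.mem_powerset.1 hB)).trans hA)).1
  · intro q _ hq
    rw [sum_prod_vanishing hc hA _ fun B hB =>
      (Finset.dvd_prod_of_mem _ (Finset.mem_powerset.2 hB)).trans hq, Polynomial.eval_finsetSum]
    refine Finset.sum_congr rfl fun B _ => ?_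
    rw [Polynomial.eval_mul, Polynomial.eval_C, Polynomial.eval_pow, Polynomial.eval_X]

end LatticePoints

/-! ### Colourings by residues modulo sign, and parity -/

section SignedColourings

open Finset

variable {K : Type*} [Field K]

theorem sum_comp_eq_sum_card_fibre {n : ℕ} {G B : Type*} [Fintype G] [Fintype B] [DecidableEq B]
    [DecidableEq G] (π : G → B) (w : (Fin n → B) → K) :
    ∑ x : Fin n → G, w (π ∘ x) =
      ∑ c : Fin n → B, w c * ∏ i, ((univ.filter fun a => π a = c i).card : K) := by
  rw [← Finset.sum_fiberwise univ (fun x : Fin n → G => π ∘ x)]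
  refine sum_congr rfl fun c _ => ?_
  rw [sum_congr rfl (g := fun _ => w c) fun x hx => by rw [(mem_filter.1 hx).2], sum_const,
    nsmul_eq_mul, mul_comm, ← Nat.cast_prod, ← Fintype.card_piFinset]
  congr 3
  ext x
  simp [funext_iff]

theorem eq_neg_iff_natAbs_valMinAbs {m : ℕ} [NeZero m] [NeZero (4 * m)] (a : ZMod (4 * m)) :
    a = -a ↔ a.valMinAbs.natAbs = 0 ∨ a.valMinAbs.natAbs = 2 * m := by
  have hle : a.valMinAbs.natAbs ≤ 2 * m := (ZMod.natAbs_valMinAbs_le a).trans (by omega)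
  have h1 : a = -a ↔ ((2 * a.valMinAbs : ℤ) : ZMod (4 * m)) = 0 := by
    rw [eq_neg_iff_add_eq_zero, ← two_mul]
    simp
  rw [h1, ZMod.intCast_zmod_eq_zero_iff_dvd]
  have hm : m ≠ 0 := NeZero.ne m
  generalize a.valMinAbs = z at *
  constructor
  · rintro ⟨k, hk⟩
    push_cast at hk
    have hz : z = 2 * m * k := by linarith
    rw [hz, Int.natAbs_mul] at hle ⊢
    have h2 : (2 * (m : ℤ)).natAbs = 2 * m := by omega
    rw [h2] at hle ⊢
    have : k.natAbs ≤ 1 := by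
      by_contra hk'
      have : 2 * m * 2 ≤ 2 * m * k.natAbs := Nat.mul_le_mul_left _ (by omega)
      omega
    interval_cases k.natAbs <;> simp
  · rintro (h | h)
    · simp [Int.natAbs_eq_zero.1 h]
    · rcases Int.natAbs_eq z with h' | h' <;> rw [h', h]
      · exact ⟨1, by push_cast; ring⟩
      · exact ⟨-1, by push_cast; ring⟩

/-- The class of `a` modulo sign. -/
def signClass {m : ℕ} [NeZero (4 * m)] (a : ZMod (4 * m)) : Fin (2 * m + 1) :=
  ⟨a.valMinAbs.natAbs, Nat.lt_succ_of_le ((ZMod.natAbs_valMinAbs_le a).trans (by omega))⟩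

theorem card_signClass_fibre {m : ℕ} [NeZero m] [NeZero (4 * m)] (k : Fin (2 * m + 1)) :
    (univ.filter fun a : ZMod (4 * m) => signClass a = k).card =
      if (k : ℕ) = 0 ∨ (k : ℕ) = 2 * m then 1 else 2 := by
  have hk : ((k : ℕ) : ZMod (4 * m)).valMinAbs.natAbs = k := by
    rw [ZMod.valMinAbs_natCast_of_le_half (by omega)]
    rfl
  have h1 : (univ.filter fun a : ZMod (4 * m) => signClass a = k) =
      {((k : ℕ) : ZMod (4 * m)), -((k : ℕ) : ZMod (4 * m))} := by
    ext a
    simp only [signClass, Fin.ext_iff, mem_filter, mem_univ, true_and, mem_insert, mem_singleton]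
    rw [← ZMod.natAbs_valMinAbs_eq_natAbs_valMinAbs, hk]
  have h2 := eq_neg_iff_natAbs_valMinAbs ((k : ℕ) : ZMod (4 * m))
  rw [hk] at h2
  rw [h1]
  split_ifs with h
  · rw [← h2.2 h]
    simp
  · exact card_pair fun h' => h (h2.1 h')

/-- Applied to the classes `1, …, 2j + 1` shifted down by one, so `O` belongs to the odd classes and
`E` to the even ones. -/
theorem prod_range_alternating {M : Type*} [CommMonoid M] (u : ℕ → M) (E O : M) (j : ℕ)
    (hO : ∀ k, k < j + 1 → u (2 * k) = O) (hE : ∀ k, k < j → u (2 * k + 1) = E) :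
    ∏ k ∈ range (2 * j + 1), u k = E ^ j * O ^ (j + 1) := by
  induction j with
  | zero => simpa using hO 0 (by omega)
  | succ j ih =>
    rw [show 2 * (j + 1) + 1 = 2 * j + 1 + 1 + 1 by ring, prod_range_succ, prod_range_succ,
      ih (fun k hk => hO k (by omega)) (fun k hk => hE k (by omega)), hE j (by omega),
      show 2 * j + 1 + 1 = 2 * (j + 1) by ring, hO (j + 1) (by omega), pow_succ E, pow_succ O (j+1)]
    ac_rfl

/-- The classes `0` and `2(j + 1)` are singletons, with pair weight `Y ^ 2` and point weights `u`,
`v`. Of the others, which have two elements and pair weight `Y`, `j` are even and `j + 1` are odd;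
the sign `s` is seen only by the odd ones. -/
theorem sum_signed_colourings [CharZero K] (n j : ℕ) (Y s u v : K) (hs : s ^ 2 = 1)
    (w : ZMod (4 * (j + 1)) → K) (hw0 : w 0 = u) (hw2 : ∀ a, a ≠ 0 → a = -a → w a = v)
    (hw1 : ∀ a, a ≠ -a → w a = 1) :
    ∑ x : Fin n → ZMod (4 * (j + 1)),
      (∏ p ∈ pairs n, (if x p.1 = x p.2 then Y else 1) * (if x p.1 = -x p.2 then Y else 1)) *
        ∏ i, (s ^ (x i).valMinAbs.natAbs * w (x i)) =
      n.factorial * PowerSeries.coeff n (deformedExp u (Y ^ 2) * deformedExp v (Y ^ 2) *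
        deformedExp 2 Y ^ j * deformedExp (2 * s) Y ^ (j + 1)) := by
  classical
  have hspow : ∀ k, s ^ (2 * k) = 1 := fun k => by rw [pow_mul, hs, one_pow]
  let g : Fin (2 * (j + 1) + 1) → K := fun k =>
    if (k : ℕ) = 0 ∨ (k : ℕ) = 2 * (j + 1) then Y ^ 2 else Y
  let t : Fin (2 * (j + 1) + 1) → K := fun k =>
    s ^ (k : ℕ) * if (k : ℕ) = 0 then u else if (k : ℕ) = 2 * (j + 1) then v else 1
  have hpair : ∀ a b : ZMod (4 * (j + 1)),
      (if a = b then Y else 1) * (if a = -b then Y else 1) =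
        if signClass a = signClass b then g (signClass a) else 1 := by
    intro a b
    have h1 : signClass a = signClass b ↔ a = b ∨ a = -b := by
      rw [← ZMod.natAbs_valMinAbs_eq_natAbs_valMinAbs]
      simp [signClass]
    have h2 := eq_neg_iff_natAbs_valMinAbs a
    have h3 : g (signClass a) = if a = -a then Y ^ 2 else Y := by simp only [g, signClass, ← h2]
    rw [h3]
    simp only [h1]
    by_cases hab : a = b
    · subst hab
      by_cases haa : a = -a
      · rw [if_pos rfl, if_pos haa, if_pos (Or.inl rfl), if_pos haa, sq]
      · rw [if_pos rfl, if_neg haa, if_pos (Or.inl rfl), if_neg haa, mul_one]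
    · by_cases hab' : a = -b
      · have haa : a ≠ -a := fun h => hab (by rw [h, hab', neg_neg])
        rw [if_neg hab, if_pos hab', if_pos (Or.inr hab'), if_neg haa, one_mul]
      · rw [if_neg hab, if_neg hab', if_neg (not_or.2 ⟨hab, hab'⟩), one_mul]
  have hsing : ∀ a : ZMod (4 * (j + 1)), s ^ a.valMinAbs.natAbs * w a = t (signClass a) := by
    intro a
    have h2 := eq_neg_iff_natAbs_valMinAbs a
    simp only [t, signClass]
    congr 1
    by_cases h0 : a = 0
    · subst h0
      simp [hw0]
    · have h0' : a.valMinAbs.natAbs ≠ 0 := by simpa using h0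
      rw [if_neg h0']
      by_cases h : a.valMinAbs.natAbs = 2 * (j + 1)
      · rw [if_pos h, hw2 a h0 (h2.2 (Or.inr h))]
      · rw [if_neg h, hw1 a fun h' => ?_]
        rcases h2.1 h' with h'' | h''
        · exact h0' h''
        · exact h h''
  simp_rw [hpair, hsing]
  have h3 := sum_comp_eq_sum_card_fibre (n := n) (signClass (m := j + 1))
    (fun c => (∏ p ∈ pairs n, (if c p.1 = c p.2 then g (c p.1) else 1)) * ∏ i, t (c i))
  simp only [Function.comp_apply, card_signClass_fibre, mul_assoc, ← prod_mul_distrib] at h3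
  -- The size of a sign class is absorbed into the weight of each point coloured by it.
  rw [h3, sum_colourings n g (fun k => t k * ((if (k : ℕ) = 0 ∨ (k : ℕ) = 2 * (j + 1) then 1 else 2 : ℕ) : K))]
  congr 2
  let f : ℕ → PowerSeries K := fun k => deformedExp
    ((s ^ k * if k = 0 then u else if k = 2 * (j + 1) then v else 1) *
      ((if k = 0 ∨ k = 2 * (j + 1) then 1 else 2 : ℕ) : K))
    (if k = 0 ∨ k = 2 * (j + 1) then Y ^ 2 else Y)
  rw [show ∏ k : Fin (2 * (j + 1) + 1), deformedExp (t k *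
    ((if (k : ℕ) = 0 ∨ (k : ℕ) = 2 * (j + 1) then 1 else 2 : ℕ) : K)) (g k) =
      ∏ k : Fin (2 * (j + 1) + 1), f k from rfl, Fin.prod_univ_eq_prod_range, prod_range_succ,
    show 2 * (j + 1) = 2 * j + 1 + 1 by ring, prod_range_succ',
    prod_range_alternating (fun k => f (k + 1)) (deformedExp 2 Y) (deformedExp (2 * s) Y)]
  · have h4 : f 0 = deformedExp u (Y ^ 2) := by simp [f]
    have h5 : f (2 * j + 1 + 1) = deformedExp v (Y ^ 2) := by
      -- The modulus is a multiple of 4 so that the class of `q/2` is even and carries no sign.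
      have : s ^ (2 * j + 1 + 1) = 1 := hspow (j + 1)
      simp [f, this, show 2 * (j + 1) = 2 * j + 1 + 1 by ring]
    rw [h4, h5]
    ring
  · intro k hk
    have h4 : ¬(2 * k + 1 = 2 * (j + 1)) := by omega
    have h5 : s ^ (2 * k + 1) = s := by rw [pow_succ, hspow, one_mul]
    simp [f, h4, h5, mul_comm s]
  · intro k hk
    have h4 : ¬(2 * k + 1 + 1 = 2 * (j + 1)) := by omega
    have h5 : s ^ (2 * k + 1 + 1) = 1 := hspow (k + 1)
    simp [f, h4, h5]

theorem even_natAbs_valMinAbs_iff {q : ℕ} (hq : 2 ∣ q) (a : ZMod q) :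
    Even a.valMinAbs.natAbs ↔ ZMod.castHom hq (ZMod 2) a = 0 := by
  rw [Int.natAbs_even]
  nth_rw 2 [← ZMod.coe_valMinAbs a]
  rw [map_intCast, ZMod.intCast_eq_zero_iff_even]

theorem neg_one_pow_natAbs_valMinAbs {q : ℕ} (hq : 2 ∣ q) (a : ZMod q) :
    (-1 : K) ^ a.valMinAbs.natAbs = if ZMod.castHom hq (ZMod 2) a = 0 then 1 else -1 := by
  rw [_root_.neg_one_pow_eq_ite]
  exact if_congr (even_natAbs_valMinAbs_iff hq a) rfl rfl

theorem prod_neg_one_pow {q : ℕ} (hq : 2 ∣ q) {κ : Type*} (s : Finset κ) (x : κ → ZMod q) :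
    ∏ i ∈ s, (-1 : K) ^ (x i).valMinAbs.natAbs = (-1) ^ (∑ i ∈ s, x i).valMinAbs.natAbs := by
  classical
  induction s using Finset.induction_on with
  | empty => simp
  | insert i s hi ih =>
    rw [prod_insert hi, sum_insert hi, ih, neg_one_pow_natAbs_valMinAbs hq,
      neg_one_pow_natAbs_valMinAbs hq, neg_one_pow_natAbs_valMinAbs hq, map_add]
    generalize ZMod.castHom hq (ZMod 2) (x i) = a
    generalize ZMod.castHom hq (ZMod 2) (∑ i ∈ s, x i) = b
    have key : ∀ a b : ZMod 2, (a + b = 0 ↔ (a = 0 ↔ b = 0)) := by decide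
    simp only [key]
    by_cases ha : a = 0 <;> by_cases hb : b = 0 <;> simp [ha, hb]

/-- For even `q`, doubling on `ℤ/q` has a kernel of order 2 and the even residues as image. -/
theorem card_halves {q : ℕ} [NeZero q] (hq : 2 ∣ q) (a : ZMod q) :
    ((univ.filter fun y : ZMod q => 2 • y = a).card : K) = 1 + (-1) ^ a.valMinAbs.natAbs := by
  rw [neg_one_pow_natAbs_valMinAbs hq]
  split_ifs with h
  · rw [← even_natAbs_valMinAbs_iff hq, Int.natAbs_even] at h
    obtain ⟨z, hz⟩ := h
    have ha : a = 2 • (z : ZMod q) := by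
      rw [← ZMod.coe_valMinAbs a, hz]
      push_cast
      ring
    have h1 := card_zmod_mul_eq_zero (q := q) (a := 2) (by simpa using hq)
    have h2 : (univ.filter fun y : ZMod q => 2 • y = a) =
        (univ.filter fun y : ZMod q => (2 : ℤ) • y = 0).map
          (Equiv.addRight (z : ZMod q)).toEmbedding := by
      ext y
      simp [ha, ← sub_eq_add_neg, mul_sub, sub_eq_zero]
    rw [h2, card_map, h1]
    norm_num
  · rw [filter_false_of_mem]
    · simp
    · rintro y - rfl
      apply h
      rw [map_nsmul]
      generalize ZMod.castHom hq (ZMod 2) y = b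
      revert b
      decide

end SignedColourings

/-! ### Root systems B, C, D and a basis of the half-integral lattice -/

section Roots

open Finset Submodule

theorem e_apply {n : ℕ} (i k : Fin n) : (e i : Fin n → ℝ) k = if k = i then 1 else 0 := by
  simp [e, Pi.single_apply]

theorem mem_pairs {n : ℕ} {p : Fin n × Fin n} : p ∈ pairs n ↔ p.1 < p.2 := by simp [pairs]

theorem e_sub_e_inj {n : ℕ} {i j k l : Fin n} (h : i < j)
    (he : (e i - e j : Fin n → ℝ) = e k - e l) : i = k ∧ j = l := by
  have h1 := congrFun he i
  have h2 := congrFun he j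
  simp only [Pi.sub_apply, e_apply, if_true, if_neg h.ne, if_neg h.ne'] at h1 h2
  constructor
  · by_contra hik
    rw [if_neg hik] at h1
    split_ifs at h1 <;> norm_num at h1
  · by_contra hjl
    rw [if_neg hjl] at h2
    split_ifs at h2 <;> norm_num at h2

theorem e_add_e_inj {n : ℕ} {i j k l : Fin n} (h : i < j) (h' : k < l)
    (he : (e i + e j : Fin n → ℝ) = e k + e l) : i = k ∧ j = l := by
  have h1 := congrFun he i
  have h2 := congrFun he j
  simp only [Pi.add_apply, e_apply, if_true, if_neg h.ne, if_neg h.ne'] at h1 h2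
  have h3 : i = k ∨ i = l := by
    by_contra hc
    rw [not_or] at hc
    simp [hc] at h1
  have h4 : j = k ∨ j = l := by
    by_contra hc
    rw [not_or] at hc
    simp [hc] at h2
  omega

theorem e_sub_e_ne_e_add_e {n : ℕ} {i j k l : Fin n} (h : i < j) :
    (e i - e j : Fin n → ℝ) ≠ e k + e l := fun he => by
  have h2 := congrFun he j
  simp only [Pi.sub_apply, Pi.add_apply, e_apply, if_true, if_neg h.ne'] at h2
  split_ifs at h2 <;> norm_num at h2

theorem e_sub_e_ne_smul_e {n : ℕ} {i j k : Fin n} (h : i < j) {a : ℝ} (ha : 0 ≤ a) :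
    (e i - e j : Fin n → ℝ) ≠ a • e k := fun he => by
  have h2 := congrFun he j
  simp only [Pi.sub_apply, Pi.smul_apply, e_apply, if_true, if_neg h.ne', smul_eq_mul] at h2
  split_ifs at h2 <;> linarith

theorem e_add_e_ne_smul_e {n : ℕ} {i j k : Fin n} (h : i < j) (a : ℝ) :
    (e i + e j : Fin n → ℝ) ≠ a • e k := fun he => by
  have h1 := congrFun he i
  have h2 := congrFun he j
  simp only [Pi.add_apply, Pi.smul_apply, e_apply, if_true, if_neg h.ne', if_neg h.ne,
    smul_eq_mul] at h1 h2
  have h3 : i = k := by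
    by_contra hc
    simp [hc] at h1
  have h4 : j = k := by
    by_contra hc
    simp [hc] at h2
  exact h.ne (h3.trans h4.symm)

theorem smul_e_injective {n : ℕ} {a : ℝ} (ha : a ≠ 0) :
    Function.Injective fun i : Fin n => a • (e i : Fin n → ℝ) := fun i j h => by
  have h1 := congrFun h i
  by_contra hij
  simp [e_apply, hij, ha] at h1

theorem prod_rootsD {M : Type*} [CommMonoid M] {n : ℕ} (φ : (Fin n → ℝ) → M) :
    ∏ v ∈ rootsD n, φ v = ∏ p ∈ pairs n, φ (e p.1 - e p.2) * φ (e p.1 + e p.2) := by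
  classical
  unfold rootsD
  rw [prod_mul_distrib, prod_union, prod_image, prod_image]
  · rintro p hp p' hp' h
    obtain ⟨h1, h2⟩ := e_add_e_inj (mem_pairs.1 hp) (mem_pairs.1 hp') h
    exact Prod.ext h1 h2
  · rintro p hp p' hp' h
    obtain ⟨h1, h2⟩ := e_sub_e_inj (mem_pairs.1 hp) h
    exact Prod.ext h1 h2
  · rw [Finset.disjoint_left]
    intro v hv hv'
    obtain ⟨p, hp, rfl⟩ := mem_image.1 hv
    obtain ⟨p', -, h⟩ := mem_image.1 hv'
    exact e_sub_e_ne_e_add_e (mem_pairs.1 hp) h.symm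

theorem mem_rootsD {n : ℕ} {v : Fin n → ℝ} :
    v ∈ rootsD n ↔ ∃ i j, i < j ∧ (v = e i - e j ∨ v = e i + e j) := by
  classical
  unfold rootsD
  simp only [mem_union, mem_image, mem_pairs, Prod.exists]
  constructor
  · rintro (⟨i, j, h, rfl⟩ | ⟨i, j, h, rfl⟩)
    · exact ⟨i, j, h, Or.inl rfl⟩
    · exact ⟨i, j, h, Or.inr rfl⟩
  · rintro ⟨i, j, h, rfl | rfl⟩
    · exact Or.inl ⟨i, j, h, rfl⟩
    · exact Or.inr ⟨i, j, h, rfl⟩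

open Classical in
theorem prod_rootsD_union {M : Type*} [CommMonoid M] {n : ℕ} (φ : (Fin n → ℝ) → M) {a : ℝ}
    (ha : 0 < a) : ∏ v ∈ rootsD n ∪ univ.image (fun i => a • e i), φ v =
      (∏ p ∈ pairs n, φ (e p.1 - e p.2) * φ (e p.1 + e p.2)) * ∏ i, φ (a • e i) := by
  rw [prod_union, prod_rootsD, prod_image fun i _ j _ h => smul_e_injective ha.ne' h]
  rw [Finset.disjoint_left]
  intro v hv hv'
  obtain ⟨k, -, rfl⟩ := mem_image.1 hv'
  obtain ⟨i, j, h, h' | h'⟩ := mem_rootsD.1 hv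
  · exact e_sub_e_ne_smul_e h ha.le h'.symm
  · exact e_add_e_ne_smul_e h a h'.symm

theorem prod_rootsB {M : Type*} [CommMonoid M] {n : ℕ} (φ : (Fin n → ℝ) → M) :
    ∏ v ∈ rootsB n, φ v =
      (∏ p ∈ pairs n, φ (e p.1 - e p.2) * φ (e p.1 + e p.2)) * ∏ i, φ (e i) := by
  have := prod_rootsD_union φ one_pos
  simp only [one_smul] at this
  exact this

theorem prod_rootsC {M : Type*} [CommMonoid M] {n : ℕ} (φ : (Fin n → ℝ) → M) :
    ∏ v ∈ rootsC n, φ v =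
      (∏ p ∈ pairs n, φ (e p.1 - e p.2) * φ (e p.1 + e p.2)) * ∏ i, φ ((2 : ℝ) • e i) :=
  prod_rootsD_union φ two_pos

theorem rootsD_subset_rootsB (n : ℕ) : rootsD n ⊆ rootsB n := by
  classical
  exact subset_union_left

theorem rootsB_subset (n : ℕ) : (rootsB n : Set (Fin n → ℝ)) ⊆ integerLattice n := by
  classical
  intro v hv
  have he : ∀ i, (e i : Fin n → ℝ) ∈ integerLattice n := fun i => subset_span ⟨i, rfl⟩
  rcases mem_union.1 (mem_coe.1 hv) with h | h
  · obtain ⟨i, j, -, rfl | rfl⟩ := mem_rootsD.1 h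
    · exact sub_mem (he i) (he j)
    · exact add_mem (he i) (he j)
  · obtain ⟨i, -, rfl⟩ := mem_image.1 h
    exact he i

theorem rootsC_subset (n : ℕ) : (rootsC n : Set (Fin n → ℝ)) ⊆ integerLattice n := by
  classical
  intro v hv
  rcases mem_union.1 (mem_coe.1 hv) with h | h
  · exact rootsB_subset n (rootsD_subset_rootsB n h)
  · obtain ⟨i, -, rfl⟩ := mem_image.1 h
    rw [two_smul]
    have he : (e i : Fin n → ℝ) ∈ integerLattice n := subset_span ⟨i, rfl⟩
    exact add_mem he he

theorem integerLattice_le (n : ℕ) : integerLattice n ≤ weightLatticeB n :=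
  span_mono Set.subset_union_left

theorem span_e_eq_top (n : ℕ) : span ℝ (Set.range (e : Fin n → Fin n → ℝ)) = ⊤ := by
  rw [← (Pi.basisFun ℝ (Fin n)).span_eq]
  congr 2
  ext i : 1
  simp [e]

theorem linearIndependent_e (n : ℕ) : LinearIndependent ℝ (e : Fin n → Fin n → ℝ) := by
  have := (Pi.basisFun ℝ (Fin n)).linearIndependent
  convert this using 1
  ext i : 1
  simp [e]

theorem rank_eq_of_e_mem {n : ℕ} {A : Finset (Fin n → ℝ)}
    (h : ∀ i, e i ∈ span ℝ (A : Set (Fin n → ℝ))) : rank A = n := by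
  have : span ℝ (A : Set (Fin n → ℝ)) = ⊤ := by
    rw [eq_top_iff, ← span_e_eq_top, span_le]
    rintro _ ⟨i, rfl⟩
    exact h i
  rw [rank, this, finrank_top, Module.finrank_fin_fun]

theorem rank_rootsB (n : ℕ) : rank (rootsB n) = n := by
  classical
  refine rank_eq_of_e_mem fun i => subset_span ?_
  exact mem_coe.2 (mem_union_right _ (mem_image_of_mem _ (mem_univ i)))

theorem rank_rootsC (n : ℕ) : rank (rootsC n) = n := by
  classical
  refine rank_eq_of_e_mem fun i => ?_
  have h : (2 : ℝ) • e i ∈ span ℝ (rootsC n : Set (Fin n → ℝ)) :=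
    subset_span (mem_coe.2 (mem_union_right _ (mem_image_of_mem _ (mem_univ i))))
  have := smul_mem _ (2⁻¹ : ℝ) h
  rwa [smul_smul, inv_mul_cancel₀ two_ne_zero, one_smul] at this

/-- For `i < j`, both basis vectors are half the sum or difference of `e i + e j` and `e i - e j`;
`D_1` is empty, hence the bound on `n`. -/
theorem rank_rootsD {n : ℕ} (hn : 2 ≤ n) : rank (rootsD n) = n := by
  classical
  have key : ∀ i j : Fin n, i < j → e i ∈ span ℝ (rootsD n : Set (Fin n → ℝ)) ∧
      e j ∈ span ℝ (rootsD n : Set (Fin n → ℝ)) := by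
    intro i j hij
    have h1 : (e i - e j : Fin n → ℝ) ∈ span ℝ (rootsD n : Set (Fin n → ℝ)) :=
      subset_span (mem_coe.2 (mem_rootsD.2 ⟨i, j, hij, Or.inl rfl⟩))
    have h2 : (e i + e j : Fin n → ℝ) ∈ span ℝ (rootsD n : Set (Fin n → ℝ)) :=
      subset_span (mem_coe.2 (mem_rootsD.2 ⟨i, j, hij, Or.inr rfl⟩))
    constructor
    · have := smul_mem _ (2⁻¹ : ℝ) (add_mem h1 h2)
      convert this using 1
      ext k
      simp
      ring
    · have := smul_mem _ (2⁻¹ : ℝ) (sub_mem h2 h1)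
      convert this using 1
      ext k
      simp
      ring
  refine rank_eq_of_e_mem fun i => ?_
  have : Nontrivial (Fin n) := Fin.nontrivial_iff_two_le.2 hn
  obtain ⟨j, hj⟩ := exists_ne i
  rcases lt_or_gt_of_ne hj with h | h
  · exact (key j i h).2
  · exact (key i j h).1

theorem rootsD_one : rootsD 1 = ∅ := by
  rw [Finset.eq_empty_iff_forall_notMem]
  intro v hv
  obtain ⟨i, j, h, -⟩ := mem_rootsD.1 hv
  exact h.ne (Subsingleton.elim _ _)

theorem coboundary_empty {V : Type*} [AddCommGroup V] [Module ℝ V] (Λ : Submodule ℤ V) :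
    coboundary Λ ∅ = 1 := by
  rw [coboundary_eq_sum, powerset_empty, sum_singleton]
  have : multiplicity Λ ∅ = 1 := by
    simp [multiplicity]
  simp [this]

/-- The basis `½(e_1 + ⋯ + e_n), e_2, …, e_n` of the weight lattice of `B_n`. -/
noncomputable def halfBasis (m : ℕ) : Fin (m + 1) → Fin (m + 1) → ℝ :=
  Fin.cons ((1 / 2 : ℝ) • ∑ i, e i) fun j => e j.succ

theorem e_zero_eq (m : ℕ) : (e 0 : Fin (m + 1) → ℝ) =
    halfBasis m 0 + halfBasis m 0 - ∑ j : Fin m, halfBasis m j.succ := by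
  simp only [halfBasis, Fin.cons_zero, Fin.cons_succ]
  rw [← add_smul, Fin.sum_univ_succ (fun i : Fin (m + 1) => (e i : Fin (m + 1) → ℝ))]
  norm_num

theorem linearIndependent_halfBasis (m : ℕ) : LinearIndependent ℝ (halfBasis m) := by
  refine linearIndependent_of_top_le_span_of_card_eq_finrank ?_ (by simp)
  rw [← span_e_eq_top, span_le]
  have h : ∀ i, halfBasis m i ∈ span ℝ (Set.range (halfBasis m)) := fun i => subset_span ⟨i, rfl⟩
  rintro _ ⟨i, rfl⟩
  refine Fin.cases ?_ (fun j => ?_) i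
  · rw [SetLike.mem_coe, e_zero_eq]
    exact sub_mem (add_mem (h 0) (h 0)) (sum_mem fun j _ => h j.succ)
  · exact h j.succ

theorem span_halfBasis (m : ℕ) :
    span ℤ (Set.range (halfBasis m)) = weightLatticeB (m + 1) := by
  apply le_antisymm
  · rw [span_le]
    rintro _ ⟨i, rfl⟩
    refine Fin.cases ?_ (fun j => ?_) i
    · exact subset_span (Or.inr rfl)
    · exact subset_span (Or.inl ⟨j.succ, rfl⟩)
  · unfold weightLatticeB
    rw [span_le]
    have h : ∀ i, halfBasis m i ∈ span ℤ (Set.range (halfBasis m)) :=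
      fun i => subset_span ⟨i, rfl⟩
    rintro _ (⟨i, rfl⟩ | rfl)
    · refine Fin.cases ?_ (fun j => ?_) i
      · rw [SetLike.mem_coe, e_zero_eq]
        exact sub_mem (add_mem (h 0) (h 0)) (sum_mem fun j _ => h j.succ)
      · exact h j.succ
    · exact h 0

theorem hasValue_e_halfBasis {m : ℕ} {R : Type*} [AddCommGroup R] (y : R) (z : Fin m → R)
    (i : Fin (m + 1)) : HasValue (linearIndependent_halfBasis m) (Fin.cons y z : Fin (m + 1) → R)
      (e i) ((Fin.cons (2 • y - ∑ j, z j) z : Fin (m + 1) → R) i) := by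
  refine Fin.cases ?_ (fun j => ?_) i
  · rw [e_zero_eq, Fin.cons_zero, two_smul]
    refine HasValue.sub (HasValue.add ?_ ?_) (HasValue.sum _ fun j _ => ?_)
    · exact HasValue.gen (x := (Fin.cons y z : Fin (m + 1) → R)) 0
    · exact HasValue.gen (x := (Fin.cons y z : Fin (m + 1) → R)) 0
    · exact HasValue.gen (x := (Fin.cons y z : Fin (m + 1) → R)) j.succ
  · exact HasValue.gen (x := (Fin.cons y z : Fin (m + 1) → R)) j.succ

/-- The argument of `G` on the left lists the values at the `e i` of the point with coordinates `x`
in `halfBasis`. A tuple of such values arises once for each half of its sum, and the weight on the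
right counts these halves. -/
theorem sum_half_eq {K : Type*} [Field K] {m q : ℕ} [NeZero q] (hq : 2 ∣ q)
    (G : (Fin (m + 1) → ZMod q) → K) :
    ∑ x : Fin (m + 1) → ZMod q, G (Fin.cons (2 • x 0 - ∑ j : Fin m, x j.succ) fun j => x j.succ) =
      ∑ x, G x * (1 + ∏ i, (-1) ^ (x i).valMinAbs.natAbs) := by
  simp_rw [prod_neg_one_pow hq, ← card_halves hq, card_filter, Nat.cast_sum, mul_sum]
  rw [← (Fin.consEquiv fun _ : Fin (m + 1) => ZMod q).sum_comp,
    ← (Fin.consEquiv fun _ : Fin (m + 1) => ZMod q).sum_comp, Fintype.sum_prod_type,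
    Fintype.sum_prod_type]
  refine sum_comm.trans (Eq.trans ?_ sum_comm)
  refine sum_congr rfl fun z _ => ?_
  rw [sum_comm]
  refine sum_congr rfl fun y _ => ?_
  simp only [Fin.consEquiv_apply, Fin.cons_zero, Fin.cons_succ, Fin.sum_univ_succ]
  rw [sum_eq_single (2 • y - ∑ j, z j)]
  · simp
    rfl
  · intro a _ ha
    rw [if_neg, Nat.cast_zero, mul_zero]
    exact fun h => ha (eq_sub_of_add_eq h.symm)
  · simp

end Roots

/-! ### Generating functions in types B, C, D -/

section TypesBCD

open Finset Submodule PowerSeries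

theorem constantCoeff_deformedExp {K : Type*} [Field K] (α β : K) :
    constantCoeff (deformedExp α β) = 1 := by
  rw [← coeff_zero_eq_constantCoeff_apply]
  simp [deformedExp]

theorem constantCoeff_F (α β : RatXY) : constantCoeff (F α β) = 1 :=
  constantCoeff_deformedExp α β

theorem isPolynomialFamily_power {S : PowerSeries RatXY} (hS : constantCoeff S = 1) :
    IsPolynomialFamily (power S) := isPolynomialFamily_binomial hS

theorem power_natCast {S : PowerSeries RatXY} (hS : constantCoeff S = 1) (m : ℕ) :
    power S (m : RatXY) = S ^ m := binomial_subst_natCast hS m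

theorem isPolynomialFamily_power_div {S : PowerSeries RatXY} (hS : constantCoeff S = 1)
    (a b : RatXY) : IsPolynomialFamily fun c => power S (c / a - b) := by
  have := (isPolynomialFamily_power hS).comp
    (Polynomial.C a⁻¹ * Polynomial.X - Polynomial.C b)
  simpa [div_eq_inv_mul] using this

/-- The right-hand side of the formulas in types `B` and `D`, with `X` replaced by `c`. -/
noncomputable def halfSeries (u v c : RatXY) : PowerSeries RatXY :=
  power (F 2 varY) (c / 4 - 1) * F u (varY ^ 2) * F v (varY ^ 2) *
    (power (F 2 varY) (c / 4) + power (F (-2) varY) (c / 4))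

/-- The right-hand side of the formula in type `C`, with `X` replaced by `c`. -/
noncomputable def integerSeries (c : RatXY) : PowerSeries RatXY :=
  power (F 2 varY) (c / 2 - 1) * F varY (varY ^ 2) ^ 2

theorem isPolynomialFamily_halfSeries (u v : RatXY) : IsPolynomialFamily (halfSeries u v) := by
  have h1 := isPolynomialFamily_power_div (constantCoeff_F 2 varY) 4 1
  have h2 := isPolynomialFamily_power_div (constantCoeff_F 2 varY) 4 0
  have h3 := isPolynomialFamily_power_div (constantCoeff_F (-2) varY) 4 0
  simp only [sub_zero] at h2 h3
  exact ((h1.mul (.const _)).mul (.const _)).mul (h2.add h3)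

theorem isPolynomialFamily_integerSeries : IsPolynomialFamily integerSeries :=
  (isPolynomialFamily_power_div (constantCoeff_F 2 varY) 2 1).mul (.const _)

/-- At `c = 4(j + 1)` the exponents are the natural numbers `j` and `j + 1`; the forms `2 * 1` and
`2 * -1` match the signs `s = ±1` of `sum_signed_colourings`. -/
theorem halfSeries_natCast (u v : RatXY) (j : ℕ) :
    halfSeries u v ((4 * (j + 1) : ℕ) : RatXY) =
      F u (varY ^ 2) * F v (varY ^ 2) * F 2 varY ^ j * F (2 * 1) varY ^ (j + 1) +
      F u (varY ^ 2) * F v (varY ^ 2) * F 2 varY ^ j * F (2 * -1) varY ^ (j + 1) := by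
  have h1 : ((4 * (j + 1) : ℕ) : RatXY) / 4 = ((j + 1 : ℕ) : RatXY) := by
    push_cast
    field_simp
  have h2 : ((j + 1 : ℕ) : RatXY) - 1 = (j : RatXY) := by simp
  unfold halfSeries
  rw [h1, h2, power_natCast (constantCoeff_F _ _), power_natCast (constantCoeff_F _ _),
    power_natCast (constantCoeff_F _ _), mul_one, mul_neg_one]
  ring

theorem integerSeries_natCast (j : ℕ) : integerSeries ((4 * (j + 1) : ℕ) : RatXY) =
    F varY (varY ^ 2) * F varY (varY ^ 2) * F 2 varY ^ j * F (2 * 1) varY ^ (j + 1) := by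
  have h1 : ((4 * (j + 1) : ℕ) : RatXY) / 2 - 1 = ((j + (j + 1) : ℕ) : RatXY) := by
    push_cast
    ring
  unfold integerSeries
  rw [h1, power_natCast (constantCoeff_F _ _), mul_one]
  ring

/-- The product over the roots of type `D`, evaluated at a point of `(ℤ/q)^n`. -/
noncomputable def signedWeight {n q : ℕ} (x : Fin n → ZMod q) : RatXY :=
  ∏ p ∈ pairs n, (if x p.1 = x p.2 then varY else 1) * (if x p.1 = -x p.2 then varY else 1)

theorem sum_signedWeight_half (n j : ℕ) (u v : RatXY) (w : ZMod (4 * (j + 1)) → RatXY)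
    (hw0 : w 0 = u) (hw2 : ∀ a, a ≠ 0 → a = -a → w a = v) (hw1 : ∀ a, a ≠ -a → w a = 1) :
    ∑ x : Fin n → ZMod (4 * (j + 1)), (signedWeight x * ∏ i, w (x i)) *
        (1 + ∏ i, (-1) ^ (x i).valMinAbs.natAbs) =
      n.factorial * coeff n (halfSeries u v ((4 * (j + 1) : ℕ) : RatXY)) := by
  rw [halfSeries_natCast, map_add, mul_add (n.factorial : RatXY)]
  have h1 := sum_signed_colourings n j varY 1 u v (one_pow 2) w hw0 hw2 hw1
  have h2 := sum_signed_colourings n j varY (-1) u v (by ring) w hw0 hw2 hw1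
  refine Eq.trans ?_ (congrArg₂ (· + ·) h1 h2)
  rw [← sum_add_distrib]
  refine sum_congr rfl fun x _ => ?_
  simp only [signedWeight, one_pow, one_mul]
  rw [prod_mul_distrib (s := univ)]
  ring

theorem sum_signedWeight_integer (n j : ℕ) :
    ∑ x : Fin n → ZMod (4 * (j + 1)), signedWeight x * ∏ i, (if x i = -x i then varY else 1) =
      n.factorial * coeff n (integerSeries ((4 * (j + 1) : ℕ) : RatXY)) := by
  rw [integerSeries_natCast]
  have h1 := sum_signed_colourings n j varY 1 varY varY (one_pow 2)
    (fun a => if a = -a then varY else 1) (by simp) (fun a _ h => if_pos h) (fun a h => if_neg h)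
  refine Eq.trans ?_ h1
  refine sum_congr rfl fun x _ => ?_
  simp only [one_pow, one_mul, signedWeight]

open Classical in
theorem prod_rootsD_hasValue {n q : ℕ} {ι : Type*} {c : ι → Fin n → ℝ}
    (hc : LinearIndependent ℝ c) (x : ι → ZMod q) (ξ : Fin n → ZMod q)
    (h : ∀ i, HasValue hc x (e i) (ξ i)) :
    ∏ p ∈ pairs n, (if HasValue hc x (e p.1 - e p.2) 0 then varY else 1) *
      (if HasValue hc x (e p.1 + e p.2) 0 then varY else 1) = signedWeight ξ := by
  unfold signedWeight
  refine prod_congr rfl fun p _ => ?_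
  congr 1
  · exact if_congr ((((h p.1).sub (h p.2)).iff_eq 0).trans sub_eq_zero) rfl rfl
  · exact if_congr ((((h p.1).add (h p.2)).iff_eq 0).trans add_eq_zero_iff_eq_neg) rfl rfl

theorem coboundary_eq_of_natCast {n r : ℕ} {ψ : RatXY} {P : Polynomial RatXY} {d : ℕ} (hd : d ≠ 0)
    (hP : P.eval varX = varX ^ r * ψ) {f : RatXY → PowerSeries RatXY} (hf : IsPolynomialFamily f)
    (h : ∀ j : ℕ, d ∣ 4 * (j + 1) → P.eval ((4 * (j + 1) : ℕ) : RatXY) =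
      n.factorial * coeff n (f ((4 * (j + 1) : ℕ) : RatXY))) :
    varX ^ r * ψ / n.factorial = coeff n (f varX) := by
  have hn : (n.factorial : RatXY) ≠ 0 := Nat.cast_ne_zero.2 (Nat.factorial_ne_zero n)
  obtain ⟨R, hR⟩ := hf n
  have h1 := eval_eq_of_frequently_nat (P := P) (Q := Polynomial.C (n.factorial : RatXY) * R)
    -- The extra factor 4 makes every sampled `q` of the form `4(j + 1)`.
    (d := d * 4) (by positivity) (fun q hq hdq => ?_) varX
  · rw [hP, Polynomial.eval_mul, Polynomial.eval_C, ← hR] at h1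
    rw [h1, mul_div_cancel_left₀ _ hn]
  · obtain ⟨k, rfl⟩ := (Dvd.intro_left _ rfl : 4 ∣ d * 4).trans hdq
    obtain ⟨j, rfl⟩ := Nat.exists_eq_succ_of_ne_zero (n := k) (by rintro rfl; simp at hq)
    rw [Nat.succ_eq_add_one] at *
    rw [h j ((Dvd.intro _ rfl).trans hdq), hR, Polynomial.eval_mul, Polynomial.eval_C]

/-- Common core of types B and D, with `w` recording the short roots `e_i`. The power of `X` is kept
because `D_1` does not have full rank. -/
theorem coboundary_half {m : ℕ} {A : Finset (Fin (m + 1) → ℝ)}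
    (hA : (A : Set (Fin (m + 1) → ℝ)) ⊆ integerLattice (m + 1)) (u v : RatXY)
    (w : ∀ q, ZMod q → RatXY) (hw0 : ∀ q, w q 0 = u)
    (hw2 : ∀ q a, a ≠ 0 → a = -a → w q a = v) (hw1 : ∀ q a, a ≠ -a → w q a = 1)
    (hprod : ∀ (q : ℕ) (x ξ : Fin (m + 1) → ZMod q),
      (∀ i, HasValue (linearIndependent_halfBasis m) x (e i) (ξ i)) → ∀ [DecidablePred fun v =>
        HasValue (linearIndependent_halfBasis m) x v 0],
      ∏ v ∈ A, (if HasValue (linearIndependent_halfBasis m) x v 0 then varY else 1) =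
        signedWeight ξ * ∏ i, w q (ξ i)) :
    varX ^ (m + 1 - rank A) * coboundary (weightLatticeB (m + 1)) A / (m + 1).factorial =
      coeff (m + 1) (halfSeries u v varX) := by
  classical
  have hA' : (A : Set (Fin (m + 1) → ℝ)) ⊆ span ℤ (Set.range (halfBasis m)) := by
    rw [span_halfBasis]
    exact hA.trans (integerLattice_le _)
  obtain ⟨P, hP, d, hd, h⟩ := exists_coboundary_polynomial (linearIndependent_halfBasis m) hA'
  rw [span_halfBasis, Fintype.card_fin] at hP
  refine coboundary_eq_of_natCast hd hP (isPolynomialFamily_halfSeries u v) fun j hj => ?_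
  rw [h _ hj, ← sum_signedWeight_half (m + 1) j u v (w _) (hw0 _) (hw2 _) (hw1 _),
    ← sum_half_eq (Dvd.intro (2 * (j + 1)) (by ring))
      fun ξ : Fin (m + 1) → ZMod (4 * (j + 1)) => signedWeight ξ * ∏ i, w _ (ξ i)]
  refine sum_congr (by ext; simp) fun x _ => ?_
  convert hprod _ x _ fun i => ?_
  have := hasValue_e_halfBasis (x 0) (fun j => x (Fin.succ j)) i
  have hx : (Fin.cons (x 0) fun j => x (Fin.succ j) : Fin (m + 1) → ZMod (4 * (j + 1))) = x :=
    Fin.cons_self_tail x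
  rwa [hx] at this

theorem constantCoeff_power {S : PowerSeries RatXY} (hS : constantCoeff S = 1) (c : RatXY) :
    constantCoeff (power S c) = 1 := by
  have := coeff_binomial_subst hS c 0
  simp only [zero_add, Finset.range_one, sum_singleton, Ring.choose_zero_right, pow_zero,
    coeff_zero_eq_constantCoeff_apply, map_one, mul_one] at this
  exact this

theorem coeff_zero_halfSeries (u v c : RatXY) : coeff 0 (halfSeries u v c) = 2 := by
  rw [coeff_zero_eq_constantCoeff_apply]
  simp only [halfSeries, map_mul, map_add, constantCoeff_power (constantCoeff_F _ _),
    constantCoeff_F]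
  norm_num

theorem PsiWB_add_one : PsiWB + 1 = halfSeries 1 varY varX := by
  classical
  ext n
  rw [map_add, PsiWB, egf, coeff_mk, coeff_one]
  cases n with
  | zero =>
    have : rootsB 0 = ∅ := by
      rw [Finset.eq_empty_iff_forall_notMem]
      intro v hv
      simp [mem_rootsD, rootsB] at hv
    rw [this, coboundary_empty, coeff_zero_halfSeries]
    norm_num
  | succ m =>
    -- The root `e_i` is killed only by the colour `0`, not by `q/2`; the order of `u` and `v` is
    -- swapped at the end by commutativity.
    have h := coboundary_half (rootsB_subset (m + 1)) varY 1
      (fun q a => if a = 0 then varY else 1) (fun q => if_pos rfl) (fun q a ha _ => if_neg ha)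
      (fun q a ha => if_neg fun h => ha (by rw [h, neg_zero])) fun q x ξ hξ _ => ?_
    · rw [rank_rootsB, Nat.sub_self, pow_zero, one_mul] at h
      rw [h, if_neg (Nat.succ_ne_zero m), add_zero]
      congr 1
      unfold halfSeries
      ring
    · rw [prod_rootsB]
      congr 1
      · rw [← prod_rootsD_hasValue _ x ξ hξ]
        convert rfl
      · exact prod_congr rfl fun i _ => if_congr ((hξ i).iff_eq 0) rfl rfl

theorem PsiWD_add : PsiWD + 1 + C (varX - 1) * X = halfSeries 1 1 varX := by
  classical
  ext n
  rw [map_add, map_add, PsiWD, egf, coeff_mk, coeff_one, coeff_C_mul, coeff_X]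
  cases n with
  | zero =>
    have : rootsD 0 = ∅ := by
      rw [Finset.eq_empty_iff_forall_notMem]
      intro v hv
      obtain ⟨i, -⟩ := mem_rootsD.1 hv
      exact i.elim0
    rw [this, coboundary_empty, coeff_zero_halfSeries]
    norm_num
  | succ m =>
    have h := coboundary_half (A := rootsD (m + 1))
      ((coe_subset.2 (rootsD_subset_rootsB _)).trans (rootsB_subset (m + 1))) 1 1
      (fun q a => 1) (fun q => rfl) (fun q a _ _ => rfl) (fun q a _ => rfl) fun q x ξ hξ _ => ?_
    · rw [← h]
      cases m with
      | zero =>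
        -- For `n = 1` the coboundary polynomial is 1 but the count gives `X ^ (1 - 0)`; the
        -- difference is the correction `(X - 1)Z`.
        have hr : rank (∅ : Finset (Fin 1 → ℝ)) = 0 := by simp [rank]
        have hA : rootsD (0 + 1) = ∅ := rootsD_one
        rw [hA, hr, coboundary_empty, coboundary_empty]
        norm_num
      | succ m =>
        rw [rank_rootsD (by omega), if_neg (by omega), if_neg (by omega), Nat.sub_self]
        simp only [weightLatticeB, weightLatticeD]
        ring
    · rw [prod_rootsD, prod_const_one, mul_one, ← prod_rootsD_hasValue _ x ξ hξ]
      convert rfl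

/-- The root `2e_i` is killed exactly when `x i = -x i`, so the colours `0` and `q/2` both have
weight `Y`. -/
theorem PsiC_eq : PsiC = integerSeries varX := by
  classical
  ext n
  rw [PsiC, egf, coeff_mk]
  obtain ⟨P, hP, d, hd, h⟩ := exists_coboundary_polynomial (linearIndependent_e n)
    (A := rootsC n) (rootsC_subset n)
  rw [Fintype.card_fin] at hP
  have h1 := coboundary_eq_of_natCast (n := n) hd hP isPolynomialFamily_integerSeries fun j hj => ?_
  · rw [rank_rootsC, Nat.sub_self, pow_zero, one_mul] at h1
    exact h1
  · rw [h _ hj, ← sum_signedWeight_integer]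
    refine sum_congr (by ext; simp) fun x _ => ?_
    have hξ : ∀ i, HasValue (linearIndependent_e n) x (e i) (x i) := HasValue.gen
    rw [prod_rootsC]
    congr 1
    · exact prod_rootsD_hasValue _ x x hξ
    · refine prod_congr rfl fun i _ => ?_
      rw [two_smul]
      exact if_congr ((((hξ i).add (hξ i)).iff_eq 0).trans add_eq_zero_iff_eq_neg) rfl rfl

end TypesBCD

/-! ### Products over roots of unity and sum-zero colourings -/

section CyclicProducts

open Finset PowerSeries

variable {K : Type*} [Field K]

/-- The product of the deformed exponentials at the `d`-th roots of unity `ω ^ k`. -/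
noncomputable def cyclicProduct (d : ℕ) (ω Y : K) : PowerSeries K :=
  ∏ k ∈ range d, deformedExp (ω ^ k) Y

theorem constantCoeff_cyclicProduct (d : ℕ) (ω Y : K) :
    constantCoeff (cyclicProduct d ω Y) = 1 := by
  simp [cyclicProduct, map_prod, constantCoeff_deformedExp]

theorem rescale_deformedExp (a α β : K) :
    rescale a (deformedExp α β) = deformedExp (a * α) β := by
  ext n
  simp only [coeff_rescale, deformedExp, coeff_mk]
  ring

theorem rescale_cyclicProduct {d : ℕ} {ω : K} (hω : ω ^ d = 1) (Y : K) :
    rescale ω (cyclicProduct d ω Y) = cyclicProduct d ω Y := by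
  cases d with
  | zero => simp [cyclicProduct]
  | succ m =>
    unfold cyclicProduct
    rw [map_prod]
    simp_rw [rescale_deformedExp, ← pow_succ']
    rw [prod_range_succ, prod_range_succ', hω, pow_zero]

/-- Replacing `Z` by `ωZ` permutes the factors cyclically, so coefficients in degrees `0 < k < d`
vanish. This is what makes the sum in type A locally finite. -/
theorem X_pow_dvd_cyclicProduct_sub_one {d : ℕ} {ω : K} (hω : IsPrimitiveRoot ω d) (Y : K) :
    X ^ d ∣ cyclicProduct d ω Y - 1 := by
  rw [X_pow_dvd_iff]
  intro k hk
  rcases Nat.eq_zero_or_pos k with rfl | hk0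
  · rw [coeff_zero_eq_constantCoeff_apply, map_sub, constantCoeff_cyclicProduct]
    simp
  · have h1 := congrArg (coeff k) (rescale_cyclicProduct hω.pow_eq_one Y)
    rw [coeff_rescale] at h1
    have h2 : ω ^ k ≠ 1 := hω.pow_ne_one_of_pos_of_lt hk0.ne' hk
    rw [map_sub, coeff_one, if_neg hk0.ne', sub_zero]
    by_contra h3
    exact h2 (mul_right_cancel₀ h3 (by rw [h1, one_mul]))

theorem coeff_binomial_cyclicProduct [BinomialRing K] {d : ℕ} {ω : K} (hω : IsPrimitiveRoot ω d)
    (Y c : K) {N : ℕ} (hN : N < d) :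
    coeff N ((binomialSeries K c).subst (cyclicProduct d ω Y - 1) - 1) = 0 := by
  rw [map_sub, coeff_binomial_subst (constantCoeff_cyclicProduct d ω Y), sum_range_succ',
    sum_eq_zero]
  · simp
  · intro k _
    have h : X ^ d ∣ (cyclicProduct d ω Y - 1) ^ (k + 1) :=
      (X_pow_dvd_cyclicProduct_sub_one hω Y).trans (dvd_pow_self _ (Nat.succ_ne_zero k))
    rw [X_pow_dvd_iff.1 h N hN, mul_zero]

theorem prod_range_pow_eq_prod_nthRootsFinset {M : Type*} [CommMonoid M] {d : ℕ} {ω : K}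
    (hω : IsPrimitiveRoot ω d) (hd : 0 < d) (f : K → M) :
    ∏ k ∈ range d, f (ω ^ k) = ∏ z ∈ Polynomial.nthRootsFinset d (1 : K), f z := by
  classical
  have hinj : Set.InjOn (fun k => ω ^ k) (range d : Set ℕ) := fun i hi j hj h =>
    hω.pow_inj (by simpa using hi) (by simpa using hj) h
  have h1 : (range d).image (fun k => ω ^ k) = Polynomial.nthRootsFinset d (1 : K) := by
    refine eq_of_subset_of_card_le ?_ ?_
    · intro z hz
      obtain ⟨k, -, rfl⟩ := mem_image.1 hz
      rw [Polynomial.mem_nthRootsFinset hd, ← pow_mul, mul_comm, pow_mul, hω.pow_eq_one, one_pow]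
    · rw [hω.card_nthRootsFinset, card_image_of_injOn hinj, card_range]
  rw [← h1, prod_image hinj]

/-- Both products run over the set of all `d`-th roots of unity. -/
theorem cyclicProduct_eq {d : ℕ} {ω η : K} (hω : IsPrimitiveRoot ω d) (hη : IsPrimitiveRoot η d)
    (hd : 0 < d) (Y : K) : cyclicProduct d ω Y = cyclicProduct d η Y := by
  unfold cyclicProduct
  rw [prod_range_pow_eq_prod_nthRootsFinset hω hd fun z => deformedExp z Y,
    prod_range_pow_eq_prod_nthRootsFinset hη hd fun z => deformedExp z Y]

theorem cyclicProduct_mul {d : ℕ} {η : K} (hη : η ^ d = 1) (Y : K) (k : ℕ) :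
    cyclicProduct (d * k) η Y = cyclicProduct d η Y ^ k := by
  induction k with
  | zero => simp [cyclicProduct]
  | succ k ih =>
    rw [pow_succ, ← ih]
    unfold cyclicProduct
    rw [Nat.mul_succ, prod_range_add]
    simp_rw [pow_add, pow_mul, hη, one_pow, one_mul]

theorem prod_zmod_eq_prod_range {M : Type*} [CommMonoid M] (q : ℕ) [NeZero q] (f : ℕ → M) :
    ∏ a : ZMod q, f a.val = ∏ k ∈ range q, f k := by
  obtain ⟨m, rfl⟩ := Nat.exists_eq_succ_of_ne_zero (NeZero.ne q)
  exact Fin.prod_univ_eq_prod_range f (m + 1)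

theorem isPrimitiveRoot_zmodChar {q : ℕ} [NeZero q] {ζ : K} (hζ : IsPrimitiveRoot ζ q)
    (c : ZMod q) :
    IsPrimitiveRoot (AddChar.zmodChar q hζ.pow_eq_one c) (addOrderOf c) := by
  rw [IsPrimitiveRoot.iff_def]
  constructor
  · rw [← AddChar.map_nsmul_eq_pow, addOrderOf_nsmul_eq_zero, AddChar.map_zero_eq_one]
  · intro l hl
    rw [← AddChar.map_nsmul_eq_pow, AddChar.zmodChar_apply, hζ.pow_eq_one_iff_dvd] at hl
    rw [addOrderOf_dvd_iff_nsmul_eq_zero, ← ZMod.val_eq_zero]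
    exact Nat.eq_zero_of_dvd_of_lt hl (ZMod.val_lt _)

theorem addChar_sum_eq_prod {A κ : Type*} [AddCommMonoid A] (ψ : AddChar A K) (s : Finset κ)
    (x : κ → A) : ψ (∑ i ∈ s, x i) = ∏ i ∈ s, ψ (x i) := by
  classical
  induction s using Finset.induction_on with
  | empty => simp
  | insert i s hi ih => rw [sum_insert hi, prod_insert hi, AddChar.map_add_eq_mul, ih]

/-- By orthogonality, `q·[∑ x i = 0]` is the sum over `c` of `∏ ψ (c * x i)`. For fixed `c` of
additive order `d`, the values `ψ (c * a)` run `q / d` times through the `d`-th roots of unity, and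
`φ(d)` elements have order `d`. -/
theorem sum_colourings_sum_eq_zero [CharZero K] (n : ℕ) {q : ℕ} [NeZero q] {ζ : K}
    (hζ : IsPrimitiveRoot ζ q) (Y : K) (ω : ℕ → K) (hω : ∀ d, 0 < d → IsPrimitiveRoot (ω d) d) :
    (q : K) * ∑ x : Fin n → ZMod q, (if ∑ i, x i = 0 then
      ∏ p ∈ pairs n, (if x p.1 = x p.2 then Y else 1) else 0) =
      n.factorial * ∑ d ∈ q.divisors,
        (d.totient : K) * coeff n (cyclicProduct d (ω d) Y ^ (q / d)) := by
  set ψ := AddChar.zmodChar q hζ.pow_eq_one with hψ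
  have hprim : ψ.IsPrimitive := AddChar.zmodChar_primitive_of_primitive_root q hζ
  have h1 : ∀ x : Fin n → ZMod q, (q : K) * (if ∑ i, x i = 0 then
      ∏ p ∈ pairs n, (if x p.1 = x p.2 then Y else 1) else 0) =
      ∑ c : ZMod q, (∏ p ∈ pairs n, (if x p.1 = x p.2 then Y else 1)) * ∏ i, ψ (c * x i) := by
    intro x
    rw [← mul_sum]
    have h2 : ∀ c, ∏ i, ψ (c * x i) = ψ (c * ∑ i, x i) := by
      intro c
      rw [mul_sum, addChar_sum_eq_prod]
    simp_rw [h2]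
    rw [AddChar.sum_mulShift _ hprim]
    split_ifs <;> simp [mul_comm]
  rw [mul_sum, sum_congr rfl fun x _ => h1 x, sum_comm]
  have h3 : ∀ c : ZMod q, ∑ x : Fin n → ZMod q,
      (∏ p ∈ pairs n, (if x p.1 = x p.2 then Y else 1)) * ∏ i, ψ (c * x i) =
      n.factorial * coeff n (cyclicProduct (addOrderOf c) (ω (addOrderOf c)) Y ^
        (q / addOrderOf c)) := by
    intro c
    rw [sum_colourings n (fun _ => Y) fun a => ψ (c * a)]
    congr 2
    have h4 : ∀ a : ZMod q, ψ (c * a) = ψ c ^ a.val := by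
      intro a
      rw [← AddChar.map_nsmul_eq_pow, nsmul_eq_mul, ZMod.natCast_zmod_val, mul_comm]
    have hη := isPrimitiveRoot_zmodChar hζ c
    have hd : addOrderOf c ∣ q := by
      have := addOrderOf_dvd_card (x := c)
      rwa [ZMod.card] at this
    have hd0 : 0 < addOrderOf c := Nat.pos_of_dvd_of_pos hd (NeZero.pos q)
    simp_rw [h4]
    rw [prod_zmod_eq_prod_range q fun k => deformedExp (ψ c ^ k) Y,
      cyclicProduct_eq (hω _ hd0) hη hd0, ← cyclicProduct_mul hη.pow_eq_one,
      Nat.mul_div_cancel' hd]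
    rfl
  rw [sum_congr rfl fun c _ => h3 c, ← mul_sum]
  congr 1
  rw [← sum_fiberwise_of_maps_to (s := univ) (t := q.divisors) (g := fun c : ZMod q => addOrderOf c)]
  · refine sum_congr rfl fun d hd => ?_
    rw [sum_congr rfl (g := fun _ => coeff n (cyclicProduct d (ω d) Y ^ (q / d)))
      fun c hc => by rw [(mem_filter.1 hc).2], sum_const, nsmul_eq_mul]
    congr 2
    exact IsAddCyclic.card_addOrderOf_eq_totient (by
      rw [Fintype.card_eq_nat_card, Nat.card_zmod]
      exact Nat.dvd_of_mem_divisors hd)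
  · intro c _
    have := addOrderOf_dvd_card (x := c)
    rw [ZMod.card] at this
    exact Nat.mem_divisors.2 ⟨this, NeZero.ne q⟩

end CyclicProducts

/-! ### The root system A in the quotient space -/

section RootsA

open Finset Submodule

theorem sum_eA (n : ℕ) : ∑ i, (eA i : SpaceA n) = 0 := by
  have h : (Submodule.Quotient.mk (∑ i, e i) : SpaceA n) = 0 :=
    (Submodule.Quotient.mk_eq_zero _).2 (mem_span_singleton_self _)
  rw [← h]
  exact (map_sum (span ℝ {(∑ i, e i : Fin n → ℝ)}).mkQ (fun i => e i) univ).symm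

theorem span_eA_eq_top (n : ℕ) : span ℝ (Set.range (eA : Fin n → SpaceA n)) = ⊤ := by
  have h := congrArg (Submodule.map (span ℝ {(∑ i, e i : Fin n → ℝ)}).mkQ) (span_e_eq_top n)
  rw [Submodule.map_span, ← Set.range_comp, Submodule.map_top, Submodule.range_mkQ] at h
  exact h

theorem finrank_spaceA (m : ℕ) : Module.finrank ℝ (SpaceA (m + 1)) = m := by
  have h := Submodule.finrank_quotient_add_finrank
    (span ℝ {(∑ i, e i : Fin (m + 1) → ℝ)})
  rw [finrank_span_singleton, Module.finrank_fin_fun] at h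
  · exact Nat.add_right_cancel h
  · intro h0
    have := congrFun h0 0
    simp [e_apply] at this

theorem eA_zero_eq (m : ℕ) : (eA 0 : SpaceA (m + 1)) = -∑ j : Fin m, eA j.succ := by
  have := sum_eA (m + 1)
  rw [Fin.sum_univ_succ] at this
  exact eq_neg_of_add_eq_zero_left this

theorem linearIndependent_eA_succ (m : ℕ) :
    LinearIndependent ℝ fun j : Fin m => (eA j.succ : SpaceA (m + 1)) := by
  refine linearIndependent_of_top_le_span_of_card_eq_finrank ?_ (by
    rw [finrank_spaceA, Fintype.card_fin])
  rw [← span_eA_eq_top, span_le]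
  have h : ∀ j : Fin m, (eA j.succ : SpaceA (m + 1)) ∈
    span ℝ (Set.range fun j : Fin m => (eA j.succ : SpaceA (m + 1))) := fun j => subset_span ⟨j, rfl⟩
  rintro _ ⟨i, rfl⟩
  refine Fin.cases ?_ h i
  rw [SetLike.mem_coe, eA_zero_eq]
  exact neg_mem (sum_mem fun j _ => h j)

theorem span_eA_succ (m : ℕ) :
    span ℤ (Set.range fun j : Fin m => (eA j.succ : SpaceA (m + 1))) = weightLatticeA (m + 1) := by
  apply le_antisymm
  · refine span_mono ?_
    rintro _ ⟨j, rfl⟩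
    exact ⟨j.succ, rfl⟩
  · unfold weightLatticeA
    rw [span_le]
    have h : ∀ j : Fin m, (eA j.succ : SpaceA (m + 1)) ∈
      span ℤ (Set.range fun j : Fin m => (eA j.succ : SpaceA (m + 1))) :=
      fun j => subset_span ⟨j, rfl⟩
    rintro _ ⟨i, rfl⟩
    refine Fin.cases ?_ h i
    rw [SetLike.mem_coe, eA_zero_eq]
    exact neg_mem (sum_mem fun j _ => h j)

theorem hasValue_eA {m : ℕ} {R : Type*} [AddCommGroup R] (z : Fin m → R) (i : Fin (m + 1)) :
    HasValue (linearIndependent_eA_succ m) z (eA i)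
      ((Fin.cons (-∑ j, z j) z : Fin (m + 1) → R) i) := by
  refine Fin.cases ?_ (fun j => HasValue.gen j) i
  rw [eA_zero_eq]
  exact (HasValue.sum _ fun j _ => HasValue.gen j).neg

/-- Representatives differ by a multiple `t` of `∑ e i`; since differences of basis vectors have
coordinate sum zero, `t = 0`. -/
theorem eA_sub_eA_inj {n : ℕ} {i j k l : Fin n} (h : i < j)
    (he : (eA i - eA j : SpaceA n) = eA k - eA l) : i = k ∧ j = l := by
  have h1 : (Submodule.Quotient.mk (e i - e j) : SpaceA n) = Submodule.Quotient.mk (e k - e l) := he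
  rw [Submodule.Quotient.eq, mem_span_singleton] at h1
  obtain ⟨t, ht⟩ := h1
  have h2 : ∑ x, (t • ∑ i, e i : Fin n → ℝ) x = 0 := by
    rw [ht]
    simp [sum_sub_distrib, e_apply]
  have h3 : t = 0 := by
    have hn : (n : ℝ) ≠ 0 := Nat.cast_ne_zero.2 fun hn => by
      subst hn
      exact i.elim0
    simpa [e_apply, hn] using h2
  rw [h3, zero_smul] at ht
  exact e_sub_e_inj h (sub_eq_zero.1 ht.symm)

theorem prod_rootsA {M : Type*} [CommMonoid M] {n : ℕ} (φ : SpaceA n → M) :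
    ∏ v ∈ rootsA n, φ v = ∏ p ∈ pairs n, φ (eA p.1 - eA p.2) := by
  classical
  unfold rootsA
  rw [prod_image]
  intro p hp p' _ h
  obtain ⟨h1, h2⟩ := eA_sub_eA_inj (mem_pairs.1 hp) h
  exact Prod.ext h1 h2

theorem rootsA_subset (n : ℕ) : (rootsA n : Set (SpaceA n)) ⊆ weightLatticeA n := by
  classical
  intro v hv
  obtain ⟨p, -, rfl⟩ := mem_image.1 (mem_coe.1 hv)
  exact sub_mem (subset_span ⟨_, rfl⟩) (subset_span ⟨_, rfl⟩)

theorem rank_rootsA (m : ℕ) : rank (rootsA (m + 1)) = m := by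
  classical
  have h1 : ∀ i j : Fin (m + 1), i < j → (eA i - eA j : SpaceA (m + 1)) ∈
      span ℝ (rootsA (m + 1) : Set (SpaceA (m + 1))) := fun i j h =>
    subset_span (mem_coe.2 (mem_image.2 ⟨(i, j), mem_pairs.2 h, rfl⟩))
  have h2 : ∀ i j : Fin (m + 1), (eA i - eA j : SpaceA (m + 1)) ∈
      span ℝ (rootsA (m + 1) : Set (SpaceA (m + 1))) := by
    intro i j
    rcases lt_trichotomy i j with h | rfl | h
    · exact h1 i j h
    · rw [sub_self]
      exact zero_mem _
    · rw [← neg_sub]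
      exact neg_mem (h1 j i h)
  have h3 : span ℝ (rootsA (m + 1) : Set (SpaceA (m + 1))) = ⊤ := by
    rw [eq_top_iff, ← span_eA_eq_top, span_le]
    rintro _ ⟨i, rfl⟩
    -- As `∑ eA j = 0`, this sum is `(m + 1) • eA i`.
    have h4 : ∑ j, (eA i - eA j : SpaceA (m + 1)) ∈
      span ℝ (rootsA (m + 1) : Set (SpaceA (m + 1))) := sum_mem fun j _ => h2 i j
    rw [sum_sub_distrib, sum_eA, sub_zero, sum_const, card_univ, Fintype.card_fin,
      ← Nat.cast_smul_eq_nsmul ℝ] at h4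
    have h5 := smul_mem _ (((m + 1 : ℕ) : ℝ)⁻¹) h4
    rwa [smul_smul, inv_mul_cancel₀ (Nat.cast_ne_zero.2 (Nat.succ_ne_zero m)), one_smul] at h5
  rw [rank, h3, finrank_top, finrank_spaceA]

theorem sum_cons_neg_sum {K : Type*} [AddCommMonoid K] {m : ℕ} {R : Type*} [AddCommGroup R]
    [Fintype R] [DecidableEq R] (G : (Fin (m + 1) → R) → K) :
    ∑ z : Fin m → R, G (Fin.cons (-∑ j, z j) z) = ∑ x, if ∑ i, x i = 0 then G x else 0 := by
  rw [← (Fin.consEquiv fun _ : Fin (m + 1) => R).sum_comp, Fintype.sum_prod_type]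
  refine Eq.trans ?_ sum_comm
  refine sum_congr rfl fun z _ => ?_
  simp only [Fin.consEquiv_apply, Fin.cons_zero, Fin.cons_succ, Fin.sum_univ_succ]
  rw [sum_eq_single (-∑ j, z j)]
  · simp
    rfl
  · intro a _ ha
    rw [if_neg]
    exact fun h => ha (eq_neg_of_add_eq_zero_left h)
  · simp

end RootsA

/-! ### Generating function in type A -/

section TypeA

open Finset Submodule PowerSeries

theorem coboundary_rootsA (m : ℕ) (ω : ℕ → RatXY) (hω : ∀ d, 0 < d → IsPrimitiveRoot (ω d) d) :
    varX * coboundary (weightLatticeA (m + 1)) (rootsA (m + 1)) / (m + 1).factorial =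
      ∑ d ∈ Icc 1 (m + 1), (d.totient : RatXY) *
        coeff (m + 1) (power (cyclicProduct d (ω d) varY) (varX / d) - 1) := by
  classical
  have hn : ((m + 1).factorial : RatXY) ≠ 0 := Nat.cast_ne_zero.2 (Nat.factorial_ne_zero _)
  have hA' : (rootsA (m + 1) : Set (SpaceA (m + 1))) ⊆
      span ℤ (Set.range fun j : Fin m => (eA j.succ : SpaceA (m + 1))) := by
    rw [span_eA_succ]
    exact rootsA_subset _
  obtain ⟨P, hP, d₀, hd₀, h⟩ := exists_coboundary_polynomial (linearIndependent_eA_succ m) hA'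
  rw [span_eA_succ, Fintype.card_fin, rank_rootsA, Nat.sub_self, pow_zero, one_mul] at hP
  have hfam : IsPolynomialFamily fun c => ∑ d ∈ Icc 1 (m + 1), (C (d.totient : RatXY) *
      (power (cyclicProduct d (ω d) varY) (c / d) + C (-1))) := by
    refine IsPolynomialFamily.sum _ fun d _ => (IsPolynomialFamily.const _).mul
      (IsPolynomialFamily.add ?_ (.const _))
    have := isPolynomialFamily_power_div (constantCoeff_cyclicProduct d (ω d) varY) d 0
    simpa only [sub_zero] using this
  obtain ⟨R, hR⟩ := hfam (m + 1)
  have hR' : ∀ c, R.eval c = ∑ d ∈ Icc 1 (m + 1), (d.totient : RatXY) *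
      coeff (m + 1) (power (cyclicProduct d (ω d) varY) (c / d) - 1) := by
    intro c
    rw [← hR, map_sum]
    refine sum_congr rfl fun d _ => ?_
    rw [coeff_C_mul, map_neg, map_one, ← sub_eq_add_neg]
  rw [← hR', div_eq_iff hn, mul_comm _ ((m + 1).factorial : RatXY)]
  -- The factor `X` matches the `q` from character orthogonality; requiring `(m + 1)! ∣ q` makes
  -- every `d ≤ m + 1` a divisor of `q`.
  have key := eval_eq_of_frequently_nat (P := Polynomial.X * P)
    (Q := Polynomial.C ((m + 1).factorial : RatXY) * R) (d := d₀ * (m + 1).factorial)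
    (by positivity) (fun q hq hdq => ?_) varX
  · rw [Polynomial.eval_mul, Polynomial.eval_mul, Polynomial.eval_X, Polynomial.eval_C, hP] at key
    exact key
  have : NeZero q := ⟨hq⟩
  obtain ⟨ζ, hζ⟩ : ∃ ζ : RatXY, IsPrimitiveRoot ζ q := ⟨_, hω q (Nat.pos_of_ne_zero hq)⟩
  have hsum := sum_colourings_sum_eq_zero (m + 1) hζ varY ω hω
  rw [← sum_cons_neg_sum fun x : Fin (m + 1) → ZMod q =>
    ∏ p ∈ pairs (m + 1), (if x p.1 = x p.2 then varY else 1)] at hsum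
  rw [Polynomial.eval_mul, Polynomial.eval_mul, Polynomial.eval_X, Polynomial.eval_C,
    h q ((Dvd.intro _ rfl).trans hdq), hR']
  refine Eq.trans ?_ (hsum.trans ?_)
  · congr 1
    refine sum_congr (by ext; simp) fun z _ => ?_
    rw [prod_rootsA]
    refine prod_congr rfl fun p _ => ?_
    exact if_congr ((((hasValue_eA z p.1).sub (hasValue_eA z p.2)).iff_eq 0).trans sub_eq_zero)
      rfl rfl
  · congr 1
    have hpow : ∀ d ∈ q.divisors, coeff (m + 1) (cyclicProduct d (ω d) varY ^ (q / d)) =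
        coeff (m + 1) (power (cyclicProduct d (ω d) varY) ((q : RatXY) / d) - 1) := by
      intro d hd
      have hd' := Nat.dvd_of_mem_divisors hd
      have hd0 : (d : RatXY) ≠ 0 := Nat.cast_ne_zero.2 (Nat.pos_of_mem_divisors hd).ne'
      rw [← Nat.cast_div hd' hd0, power_natCast (constantCoeff_cyclicProduct _ _ _), map_sub,
        coeff_one, if_neg (Nat.succ_ne_zero m), sub_zero]
    rw [sum_congr rfl fun d hd => by rw [hpow d hd]]
    symm
    -- Divisors `d > m + 1` of `q` contribute nothing in degree `m + 1`.
    refine sum_subset ?_ ?_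
    · intro d hd
      rw [mem_Icc] at hd
      exact Nat.mem_divisors.2 ⟨((Nat.dvd_factorial hd.1 hd.2).trans (Dvd.intro_left _ rfl)).trans
        hdq, hq⟩
    · intro d hd hd'
      have hd0 := Nat.pos_of_mem_divisors hd
      rw [mem_Icc, not_and, not_le] at hd'
      have hc := coeff_binomial_cyclicProduct (hω d hd0) varY ((q : RatXY) / d) (hd' hd0)
      exact (congrArg (fun t => (d.totient : RatXY) * t) hc).trans (mul_zero _)

theorem hasFormalSum_typeA (ω : ℕ+ → ℂ) (hω : ∀ n : ℕ+, IsPrimitiveRoot (ω n) n) :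
    HasFormalSum
      (fun n : ℕ+ => C ((n : ℕ).totient : RatXY) *
        (power (∏ k ∈ range (n : ℕ), F (algebraMap ℂ RatXY (ω n ^ k)) varY)
          (varX / ((n : ℕ) : RatXY)) - 1))
      (PsiWA - 1) := by
  -- The value at `d = 0` is a default that plays no role.
  let η : ℕ → RatXY := fun d => algebraMap ℂ RatXY (ω d.toPNat')
  have hη : ∀ d, 0 < d → IsPrimitiveRoot (η d) d := by
    intro d hd
    have h := hω d.toPNat'
    rw [Nat.toPNat'_coe, if_pos hd] at h
    exact h.map_of_injective (algebraMap ℂ RatXY).injective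
  have hS : ∀ n : ℕ+, ∏ k ∈ range (n : ℕ), F (algebraMap ℂ RatXY (ω n ^ k)) varY =
      cyclicProduct n (η n) varY := by
    intro n
    refine prod_congr rfl fun k _ => ?_
    simp only [η, map_pow, PNat.coe_toPNat']
    rfl
  have hzero : ∀ (N : ℕ) (n : ℕ+), N < n → coeff N
      (C ((n : ℕ).totient : RatXY) * (power (cyclicProduct n (η n) varY) (varX / (n : ℕ)) - 1)) =
      0 := by
    intro N n hN
    have hc := coeff_binomial_cyclicProduct (hη n n.pos) varY (varX / ((n : ℕ) : RatXY)) hN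
    rw [coeff_C_mul]
    exact (congrArg (fun t => ((n : ℕ).totient : RatXY) * t) hc).trans (mul_zero _)
  simp_rw [hS]
  intro N
  cases N with
  | zero =>
    simp_rw [fun n : ℕ+ => hzero 0 n n.pos]
    simp [PsiWA, egf]
  | succ m =>
    have hsub : (Function.support fun n : ℕ+ => coeff (m + 1) (C ((n : ℕ).totient : RatXY) *
        (power (cyclicProduct n (η n) varY) (varX / (n : ℕ)) - 1))) ⊆
        (Icc (1 : ℕ+) m.succPNat : Finset ℕ+) := by
      intro n hn
      by_contra hn'
      refine hn (hzero _ n ?_)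
      rw [coe_Icc, Set.mem_Icc, not_and, not_le] at hn'
      exact hn' _root_.one_le
    refine ⟨(finite_toSet _).subset hsub, ?_⟩
    rw [finsum_eq_sum_of_support_subset _ hsub, map_sub, PsiWA, egf, coeff_mk, coeff_one,
      if_neg (Nat.succ_ne_zero m), if_neg (Nat.succ_ne_zero m), sub_zero,
      coboundary_rootsA m η hη]
    have hI : Icc 1 (m + 1) = (Icc (1 : ℕ+) m.succPNat).map
        ⟨fun n : ℕ+ => (n : ℕ), PNat.coe_injective⟩ :=
      (PNat.map_subtype_embedding_Icc 1 m.succPNat).symm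
    rw [hI, sum_map]
    exact sum_congr rfl fun n _ => coeff_C_mul _ _ _

end TypeA

end ArithmeticTutte

open ArithmeticTutte in
theorem theorem1p10 :
    (∀ ω : ℕ+ → ℂ, (∀ n : ℕ+, IsPrimitiveRoot (ω n) n) →
      HasFormalSum
        (fun n : ℕ+ => PowerSeries.C ((n : ℕ).totient : RatXY) *
          (power (∏ k ∈ Finset.range (n : ℕ), F (algebraMap ℂ RatXY (ω n ^ k)) varY)
            (varX / ((n : ℕ) : RatXY)) - 1))
        (PsiWA - 1)) ∧
    PsiWB + 1 =
      power (F 2 varY) (varX / 4 - 1) * F 1 (varY ^ 2) * F varY (varY ^ 2) *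
        (power (F 2 varY) (varX / 4) + power (F (-2) varY) (varX / 4)) ∧
    (PsiWC = power (F 2 varY) (varX / 2 - 1) * F varY (varY ^ 2) ^ 2 ∧ PsiWC = PsiC) ∧
    PsiWD + 1 + PowerSeries.C (varX - 1) * PowerSeries.X =
      power (F 2 varY) (varX / 4 - 1) * F 1 (varY ^ 2) ^ 2 *
        (power (F 2 varY) (varX / 4) + power (F (-2) varY) (varX / 4)) := by
  -- The weight lattice of `C_n` is definitionally the integer lattice, so `PsiC_eq` serves for
  -- `PsiWC` as well.
  refine ⟨hasFormalSum_typeA, PsiWB_add_one, ⟨PsiC_eq, rfl⟩, ?_⟩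
  rw [PsiWD_add, halfSeries, sq (F 1 (varY ^ 2)), ← mul_assoc]
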